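/- Let $s_1 < s_2 < s_3 < \dots$ (that is, $1,2,4,5,8,\dots$) be the positive integers that can be written as $a^2+b^2$ with integers $a,b$, in increasing order. For every real $\gamma$ with $1<\gamma\le 2$ there is a constant $C>0$, depending only on $\gamma$, such that for all real $x\ge 2$ $$\sum_{n\ge 1,\; s_{n+1}\le x}(s_{n+1}-s_n)^\gamma\;\le\; C\,x\,(\ln x)^{\frac32(\gamma-1)}\,\delta(x,\gamma),$$ where $\delta(x,\gamma)=1$ if $\gamma<2$ and $\delta(x,\gamma)=\ln x$ if $\gamma=2$. -/

import Mathlib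

/-- `m` is a positive integer that is a sum of two squares of integers. -/
def IsPosSumTwoSq (m : ℕ) : Prop :=
  0 < m ∧ ∃ a b : ℤ, (m : ℤ) = a ^ 2 + b ^ 2

/-- The increasing enumeration `1 < 2 < 4 < 5 < 8 < …` of the positive sums of two squares.
The index starts at `0`, so `sumTwoSqSeq n` is the `(n + 1)`-st such number. -/
noncomputable def sumTwoSqSeq (n : ℕ) : ℕ := Nat.nth IsPosSumTwoSq n

theorem infinite_isPosSumTwoSq : {m : ℕ | IsPosSumTwoSq m}.Infinite := by
  refine Set.infinite_of_injective_forall_mem (f := fun k : ℕ => (k + 1) ^ 2) ?_ ?_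
  · intro a b h
    have h2 := Nat.pow_left_injective (n := 2) (by norm_num) h
    simpa using h2
  · intro k
    exact ⟨by positivity, (k : ℤ) + 1, 0, by push_cast; ring⟩

theorem sumTwoSqSeq_strictMono : StrictMono sumTwoSqSeq :=
  Nat.nth_strictMono infinite_isPosSumTwoSq

theorem range_sumTwoSqSeq : Set.range sumTwoSqSeq = {m : ℕ | IsPosSumTwoSq m} :=
  Nat.range_nth_of_infinite infinite_isPosSumTwoSq

/-- Only finitely many gaps end at or before `x`. -/
theorem finite_gapIndex (x : ℝ) : {n : ℕ | (sumTwoSqSeq (n + 1) : ℝ) ≤ x}.Finite := by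
  refine (Set.finite_Iic ⌊x⌋₊).subset fun n hn => ?_
  have h1 : sumTwoSqSeq (n + 1) ≤ ⌊x⌋₊ := Nat.le_floor hn
  have h2 : n + 1 ≤ sumTwoSqSeq (n + 1) := sumTwoSqSeq_strictMono.le_apply
  exact Set.mem_Iic.2 (by omega)

/-- The `γ`-th moment of the gaps between consecutive positive sums of two squares, taken over all
pairs of consecutive ones of which the larger is at most `x`. -/
noncomputable def gapMoment (γ x : ℝ) : ℝ :=
  ∑ n ∈ (finite_gapIndex x).toFinset,
    ((sumTwoSqSeq (n + 1) : ℝ) - (sumTwoSqSeq n : ℝ)) ^ γ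

/-- The factor that is `ln x` at the endpoint `γ = 2`, and `1` for `γ < 2`. -/
noncomputable def endpointFactor (x γ : ℝ) : ℝ :=
  if γ < 2 then 1 else Real.log x

/-! Let r(n) count the representations of n as a sum of two squares; its mean value is π. The series
∑ (r(n) - π) q^n with q = e^{πiτ}, τ = α + iy, is E = θ(τ)² - π/(1 - q). If the h integers from m on
are not sums of two squares, each contributes a coefficient of size π|q|^n, which is of constant
order for n ≤ x when y = 1/(100x). Multiplying E by the kernel D(α) = ∑_{j<h} e^{-πijα} adds up h
consecutive coefficients, so Bessel's inequality bounds (number of empty windows) · h² by a constant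
times ∫ |E|²|D|².

That integral is estimated cusp by cusp. Modular invariance gives |θ(τ)|⁴ ≤ C/|cτ + d|² for a
suitable coprime pair (c, d), so |E|² is essentially a sum of Lorentzian peaks at the fractions
±p/c; near 0 the singularity i/τ of θ² is removed by the subtracted mean. A peak has mass about
1/(c²y), and |D|² ≤ min(h², 1/α²) gives it weight min(h², 4c²/p²). Summing over p yields h/(cy), and
over c yields (h/y) log(1/y). With h ≤ 3√x, forced by the perfect squares, the windows number at
most C x log x / h (`exists_card_windows_mul_le`).

A gap of length L contains L - h windows, so ∑ (L - h)⁺ ≤ C x log x / h. Dyadic summation over h =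
2^j ⌈log x⌉ (`rpow_le_sum_excess`) gives the moment bound with exponent γ - 1 on log x, which is
stronger than 3(γ - 1)/2; the ratio 2^{γ-2} of the geometric series equals 1 exactly when γ = 2, and
the number of levels then costs the extra logarithm. -/

section

open Complex MatrixGroups
open scoped UpperHalfPlane

/-! ### Modular invariance and the size of theta at the cusps -/

/-- n² and n have the same parity, so e^{πin²} = e^{πin}. -/
theorem jacobiTheta₂_add_one_right (z τ : ℂ) :
    jacobiTheta₂ z (τ + 1) = jacobiTheta₂ (z + 1 / 2) τ := by
  refine tsum_congr fun n => ?_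
  simp_rw [jacobiTheta₂_term]
  obtain ⟨k, hk⟩ := Int.even_mul_succ_self (n - 1)
  have hk' : (n : ℂ) ^ 2 = n + 2 * k := by
    have : n ^ 2 = n + 2 * k := by linarith
    exact_mod_cast this
  have h := Complex.exp_int_mul_two_pi_mul_I k
  have e : 2 * (Real.pi : ℂ) * I * n * z + Real.pi * I * (n : ℂ) ^ 2 * (τ + 1) =
      (2 * Real.pi * I * n * (z + 1 / 2) + Real.pi * I * (n : ℂ) ^ 2 * τ) +
        k * (2 * Real.pi * I) := by
    linear_combination (Real.pi * I) * hk'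
  rw [e, Complex.exp_add, h, mul_one]

/-- The theta constant `θ₂`, the transform of `jacobiTheta₂ (1 / 2)` under `τ ↦ -1 / τ`. -/
noncomputable def thetaTwo (τ : ℂ) : ℂ :=
  cexp (Real.pi * I * τ / 4) * jacobiTheta₂ (τ / 2) τ

/-- The sum of the fourth powers of the three theta constants, weighted to be modular invariant. -/
noncomputable def thetaQuartic (τ : ℍ) : ℝ :=
  τ.im * (‖thetaTwo τ‖ ^ 4 + ‖jacobiTheta₂ 0 τ‖ ^ 4 + ‖jacobiTheta₂ (1 / 2) τ‖ ^ 4)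

/-- Translation exchanges the constants at z = 0 and z = 1/2 and multiplies `thetaTwo` by a number
of modulus 1. -/
theorem thetaQuartic_vadd_one (τ : ℍ) : thetaQuartic ((1 : ℝ) +ᵥ τ) = thetaQuartic τ := by
  have h : (((1 : ℝ) +ᵥ τ : ℍ) : ℂ) = (τ : ℂ) + 1 := by
    rw [UpperHalfPlane.coe_vadd]; push_cast; ring
  have h2 : ‖thetaTwo ((τ : ℂ) + 1)‖ = ‖thetaTwo τ‖ := by
    unfold thetaTwo
    rw [jacobiTheta₂_add_one_right, show ((τ : ℂ) + 1) / 2 + 1 / 2 = τ / 2 + 1 by ring,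
      jacobiTheta₂_add_left, norm_mul, norm_mul, Complex.norm_exp, Complex.norm_exp]
    congr 2
    simp [mul_add, add_div]
  have h4 : jacobiTheta₂ (1 / 2) ((τ : ℂ) + 1) = jacobiTheta₂ 0 τ := by
    rw [jacobiTheta₂_add_one_right, show (1 / 2 : ℂ) + 1 / 2 = 0 + 1 by norm_num,
      jacobiTheta₂_add_left]
  rw [thetaQuartic, thetaQuartic, h, h2, h4, jacobiTheta₂_add_one_right, zero_add,
    UpperHalfPlane.vadd_im]
  ring

theorem norm_neg_I_mul_cpow_half_pow_four (τ : ℂ) :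
    ‖(-I * τ) ^ (1 / 2 : ℂ)‖ ^ 4 = ‖τ‖ ^ 2 := by
  have h : ((-I * τ) ^ (1 / 2 : ℂ)) ^ 2 = -I * τ := by
    rw [← Complex.cpow_nat_mul]; norm_num
  calc ‖(-I * τ) ^ (1 / 2 : ℂ)‖ ^ 4 = ‖((-I * τ) ^ (1 / 2 : ℂ)) ^ 2‖ ^ 2 := by
        rw [norm_pow]; ring
    _ = ‖τ‖ ^ 2 := by rw [h]; simp

theorem norm_jacobiTheta₂_half_inversion (τ : ℂ) (h0 : τ ≠ 0) :
    ‖thetaTwo (-1 / τ)‖ ^ 4 = ‖τ‖ ^ 2 * ‖jacobiTheta₂ (1 / 2) τ‖ ^ 4 := by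
  have hn := norm_neg_I_mul_cpow_half_pow_four τ
  have hne : ‖τ‖ ^ 2 ≠ 0 := by positivity
  rw [jacobiTheta₂_functional_equation (1 / 2) τ, thetaTwo,
    show (-1 / τ) / 2 = -((1 / 2) / τ) by field_simp, jacobiTheta₂_neg_left,
    show (Real.pi : ℂ) * I * (-1 / τ) / 4 = -Real.pi * I * (1 / 2) ^ 2 / τ by field_simp; norm_num,
    norm_mul, norm_mul, norm_mul, norm_div, mul_pow, mul_pow, mul_pow, div_pow ‖(1 : ℂ)‖, hn]
  field_simp
  simp

theorem norm_jacobiTheta₂_zero_inversion (τ : ℂ) (h0 : τ ≠ 0) :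
    ‖jacobiTheta₂ 0 (-1 / τ)‖ ^ 4 = ‖τ‖ ^ 2 * ‖jacobiTheta₂ 0 τ‖ ^ 4 := by
  have hn := norm_neg_I_mul_cpow_half_pow_four τ
  have hne : ‖τ‖ ^ 2 ≠ 0 := by positivity
  rw [jacobiTheta₂_functional_equation 0 τ]
  simp only [norm_mul, norm_div, mul_pow, div_pow, hn, zero_div]
  field_simp
  simp

/-- Inversion exchanges `thetaTwo` with the constant at z = 1/2 and preserves the one at z = 0; the
common factor |τ|² cancels against the change of the imaginary part. -/
theorem thetaQuartic_S_smul (τ : ℍ) : thetaQuartic (ModularGroup.S • τ) = thetaQuartic τ := by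
  have h0 : (τ : ℂ) ≠ 0 := τ.ne_zero
  have hne : ‖(τ : ℂ)‖ ≠ 0 := by positivity
  have hc : ((ModularGroup.S • τ : ℍ) : ℂ) = -1 / τ := by
    rw [UpperHalfPlane.modular_S_smul]
    simp [neg_div, inv_neg]
  have him : (ModularGroup.S • τ : ℍ).im = τ.im / ‖(τ : ℂ)‖ ^ 2 := by
    rw [ModularGroup.im_smul_eq_div_normSq, ModularGroup.denom_S, Complex.normSq_eq_norm_sq]
  have h4 : ‖jacobiTheta₂ (1 / 2) (-1 / (τ : ℂ))‖ ^ 4 = ‖(τ : ℂ)‖ ^ 2 * ‖thetaTwo τ‖ ^ 4 := by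
    have := norm_jacobiTheta₂_half_inversion (-1 / τ) (div_ne_zero (by norm_num) h0)
    rw [show -1 / (-1 / (τ : ℂ)) = τ by field_simp] at this
    rw [this, norm_div, norm_neg, norm_one]
    field_simp
  rw [thetaQuartic, thetaQuartic, hc, him, norm_jacobiTheta₂_half_inversion _ h0,
    norm_jacobiTheta₂_zero_inversion _ h0, h4]
  field_simp
  ring

theorem thetaQuartic_smul (g : SL(2, ℤ)) (τ : ℍ) : thetaQuartic (g • τ) = thetaQuartic τ := by
  have hg : g ∈ Subgroup.closure {ModularGroup.S, ModularGroup.T} := by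
    simp [SpecialLinearGroup.SL2Z_generators]
  induction hg using Subgroup.closure_induction generalizing τ with
  | mem x hx =>
    rcases hx with rfl | rfl
    · exact thetaQuartic_S_smul τ
    · rw [UpperHalfPlane.modular_T_smul, thetaQuartic_vadd_one]
  | one => simp
  | mul x y _ _ hx hy => rw [mul_smul, hx, hy]
  | inv x _ hx =>
    have := hx (x⁻¹ • τ)
    rw [smul_inv_smul] at this
    exact this.symm

/-- Each term of the three series has modulus decreasing in Im τ, so the values at i/2 dominate. -/
theorem thetaQuartic_le :
    ∃ C : ℝ, 0 < C ∧ ∀ τ : ℍ, 1 / 2 ≤ τ.im → thetaQuartic τ ≤ C * τ.im := by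
  set τ₀ : ℂ := I / 2 with hτ₀
  have him0 : τ₀.im = 1 / 2 := by simp [hτ₀]
  have hpos : 0 < τ₀.im := by rw [him0]; norm_num
  have hsum (z : ℂ) : Summable fun n : ℤ => ‖jacobiTheta₂_term n z τ₀‖ :=
    ((summable_jacobiTheta₂_term_iff z τ₀).2 hpos).norm
  set B : ℝ := ∑' n : ℤ, ‖jacobiTheta₂_term n 0 τ₀‖ with hB
  set B' : ℝ := ∑' n : ℤ, ‖cexp (Real.pi * I * τ₀ / 4) * jacobiTheta₂_term n (τ₀ / 2) τ₀‖ with hB'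
  have hBr (x : ℝ) (τ : ℂ) (h : 1 / 2 ≤ τ.im) : ‖jacobiTheta₂ x τ‖ ≤ B := by
    refine tsum_of_norm_bounded (hsum 0).hasSum fun n => ?_
    rw [norm_jacobiTheta₂_term, norm_jacobiTheta₂_term]
    refine Real.exp_le_exp.2 ?_
    rw [him0]
    simp only [Complex.ofReal_im, mul_zero, sub_zero, Complex.zero_im]
    have : 0 ≤ Real.pi * (n : ℝ) ^ 2 := by positivity
    nlinarith
  have hB'r (τ : ℂ) (h : 1 / 2 ≤ τ.im) : ‖thetaTwo τ‖ ≤ B' := by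
    rw [thetaTwo, jacobiTheta₂, ← tsum_mul_left]
    -- The prefactor completes the square: n² + n + 1/4 = (n + 1/2)².
    have key (σ : ℂ) (n : ℤ) :
        ‖cexp (Real.pi * I * σ / 4) * jacobiTheta₂_term n (σ / 2) σ‖ =
          Real.exp (-(Real.pi * (n + 1 / 2) ^ 2) * σ.im) := by
      rw [norm_mul, norm_jacobiTheta₂_term, Complex.norm_exp, ← Real.exp_add]
      congr 1
      simp
      ring
    refine tsum_of_norm_bounded (Summable.hasSum ?_) fun n => ?_
    · simp_rw [norm_mul]
      exact (hsum _).mul_left _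
    · rw [key, key]
      refine Real.exp_le_exp.2 ?_
      rw [him0]
      have : 0 ≤ Real.pi * ((n : ℝ) + 1 / 2) ^ 2 := by positivity
      nlinarith
  refine ⟨B' ^ 4 + B ^ 4 + B ^ 4 + 1, ?_, fun τ hτ => ?_⟩
  · have : 0 ≤ B := by positivity
    have : 0 ≤ B' := by positivity
    positivity
  · rw [thetaQuartic, mul_comm]
    have h1 := hBr 0 τ hτ
    have h2 := hBr (1 / 2) τ hτ
    have h3 := hB'r τ hτ
    push_cast at h1 h2
    have a1 := pow_le_pow_left₀ (norm_nonneg _) h1 4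
    have a2 := pow_le_pow_left₀ (norm_nonneg _) h2 4
    have a3 := pow_le_pow_left₀ (norm_nonneg _) h3 4
    exact mul_le_mul_of_nonneg_right (by linarith) τ.im_pos.le

/-- The theta function at `τ` is controlled by the cusp nearest to `τ`. -/
theorem exists_jacobiTheta_pow_four_le :
    ∃ C : ℝ, 0 < C ∧ ∀ τ : ℍ, ∃ c d : ℤ, IsCoprime c d ∧
      ‖(c : ℂ) * τ + d‖ ^ 2 ≤ 2 * τ.im ∧
      ‖jacobiTheta τ‖ ^ 4 * ‖(c : ℂ) * τ + d‖ ^ 2 ≤ C := by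
  obtain ⟨C, hC, hle⟩ := thetaQuartic_le
  refine ⟨C, hC, fun τ => ?_⟩
  -- The bottom row (c, d) of a reducing matrix works: Im gτ = Im τ / |cτ + d|² turns the lower
  -- bound on the height into the first inequality, and `thetaQuartic_le` at gτ into the second.
  obtain ⟨g, hg⟩ := ModularGroup.exists_one_half_le_im_smul τ
  refine ⟨g 1 0, g 1 1, Matrix.SpecialLinearGroup.isCoprime_row g 1, ?_⟩
  have him : (g • τ).im = τ.im / ‖(g 1 0 : ℂ) * τ + g 1 1‖ ^ 2 := by
    rw [ModularGroup.im_smul_eq_div_normSq, ModularGroup.denom_apply, Complex.normSq_eq_norm_sq]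
  have h1 := hle _ hg
  have hpos := τ.im_pos
  have hN : 0 < ‖(g 1 0 : ℂ) * τ + g 1 1‖ ^ 2 := by
    by_contra hcon
    have h0 : ‖(g 1 0 : ℂ) * τ + g 1 1‖ ^ 2 = 0 := le_antisymm (not_lt.1 hcon) (by positivity)
    rw [him, h0] at hg
    norm_num at hg
  rw [thetaQuartic_smul, him] at h1
  rw [him, le_div_iff₀ hN] at hg
  refine ⟨by linarith, ?_⟩
  have h2 : τ.im * ‖jacobiTheta τ‖ ^ 4 ≤ thetaQuartic τ := by
    rw [thetaQuartic, jacobiTheta_eq_jacobiTheta₂]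
    gcongr
    have : 0 ≤ ‖thetaTwo τ‖ ^ 4 := by positivity
    have : 0 ≤ ‖jacobiTheta₂ (1 / 2) (τ : ℂ)‖ ^ 4 := by positivity
    linarith
  have h3 := h2.trans h1
  rw [← mul_div_assoc, le_div_iff₀ hN] at h3
  nlinarith

/-! ### Pointwise bounds for the excess series -/

/-- The generating function at `α + i y` of the excess of the number of representations as a sum
of two squares over its mean value `π`. -/
noncomputable def excessSeries (y α : ℝ) : ℂ :=
  jacobiTheta (α + y * I) ^ 2 - Real.pi / (1 - cexp (Real.pi * I * (α + y * I)))

/-- With ρ = e^{-πy} the right side is (1 - ρ)² + 2ρ(1 - cos πα), and 1 - cos πα ≥ 2α² for |α| ≤ 1.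
-/
theorem norm_sq_one_sub_exp_ge {α : ℝ} (hα : |α| ≤ 1) (y : ℝ) :
    4 * Real.exp (-(Real.pi * y)) * α ^ 2 ≤ ‖1 - cexp (Real.pi * I * (α + y * I))‖ ^ 2 := by
  have he : (Real.pi : ℂ) * I * (α + y * I) = (-(Real.pi * y) : ℝ) + (Real.pi * α : ℝ) * I := by
    push_cast
    linear_combination (Real.pi * y : ℂ) * I_mul_I
  have hcos := Real.cos_le_one_sub_mul_cos_sq (x := Real.pi * α) (by
    rw [abs_mul, abs_of_pos Real.pi_pos]
    nlinarith [Real.pi_pos])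
  have hcos' : Real.cos (Real.pi * α) ≤ 1 - 2 * α ^ 2 := by
    refine hcos.trans_eq ?_
    have := Real.pi_pos.ne'
    field_simp
  rw [he, Complex.exp_add, ← Complex.ofReal_exp, ← Complex.normSq_eq_norm_sq, Complex.normSq_apply]
  have hre : (1 - (Real.exp (-(Real.pi * y)) : ℂ) * cexp ((Real.pi * α : ℝ) * I)).re =
      1 - Real.exp (-(Real.pi * y)) * Real.cos (Real.pi * α) := by
    rw [Complex.sub_re, Complex.re_ofReal_mul, Complex.exp_ofReal_mul_I_re, Complex.one_re]
  have him : (1 - (Real.exp (-(Real.pi * y)) : ℂ) * cexp ((Real.pi * α : ℝ) * I)).im =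
      - (Real.exp (-(Real.pi * y)) * Real.sin (Real.pi * α)) := by
    rw [Complex.sub_im, Complex.im_ofReal_mul, Complex.exp_ofReal_mul_I_im, Complex.one_im]
    ring
  rw [hre, him]
  have hρ := Real.exp_pos (-(Real.pi * y))
  have hsc := Real.sin_sq_add_cos_sq (Real.pi * α)
  set ρ := Real.exp (-(Real.pi * y))
  nlinarith [sq_nonneg (1 - ρ), mul_le_mul_of_nonneg_left hcos' hρ.le,
    congrArg (fun t => ρ ^ 2 * t) hsc]

theorem norm_sq_geom_sum_exp_le {α : ℝ} (hα : |α| ≤ 1) (h : ℕ) :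
    ‖∑ j ∈ Finset.range h, cexp (Real.pi * I * α) ^ j‖ ^ 2 * α ^ 2 ≤ 1 := by
  have h1 := norm_sq_one_sub_exp_ge hα 0
  simp only [mul_zero, neg_zero, Real.exp_zero, mul_one, Complex.ofReal_zero, zero_mul,
    add_zero] at h1
  set w := cexp (Real.pi * I * α) with hw
  have hn : ‖w‖ = 1 := by
    rw [hw, Complex.norm_exp]; simp
  have h2 : (∑ j ∈ Finset.range h, w ^ j) * (1 - w) = 1 - w ^ h := by
    rw [geom_sum_mul_neg]
  have h3 : ‖∑ j ∈ Finset.range h, w ^ j‖ * ‖1 - w‖ ≤ 2 := by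
    rw [← norm_mul, h2]
    refine (norm_sub_le _ _).trans ?_
    rw [norm_pow, hn]; norm_num
  have h4 := pow_le_pow_left₀ (by positivity) h3 2
  rw [mul_pow] at h4
  have := mul_le_mul_of_nonneg_left h1 (sq_nonneg ‖∑ j ∈ Finset.range h, w ^ j‖)
  nlinarith

theorem norm_inv_exp_sub_one_sub_inv_le {z : ℂ} (h0 : z ≠ 0) (hz : ‖z‖ ≤ 1 / 2) :
    ‖1 / (cexp z - 1) - 1 / z‖ ≤ 2 := by
  have h1 : ‖cexp z - 1 - z‖ ≤ ‖z‖ ^ 2 := Complex.norm_exp_sub_one_sub_id_le (by linarith)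
  have hp : 0 < ‖z‖ := norm_pos_iff.2 h0
  have h2 : ‖z‖ / 2 ≤ ‖cexp z - 1‖ := by
    have := norm_sub_le (cexp z - 1) (cexp z - 1 - z)
    rw [sub_sub_cancel] at this
    nlinarith
  have h3 : cexp z - 1 ≠ 0 := norm_pos_iff.1 (by linarith)
  rw [div_sub_div _ _ h3 h0, norm_div, norm_mul, div_le_iff₀ (by positivity)]
  rw [show 1 * z - (cexp z - 1) * 1 = -(cexp z - 1 - z) by ring, norm_neg]
  nlinarith

theorem norm_jacobiTheta_sq_sub_one_le {σ : ℂ} (hσ : 1 / 3 ≤ σ.im) :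
    ‖jacobiTheta σ ^ 2 - 1‖ ≤ 16 * Real.exp (-Real.pi * σ.im) := by
  have h1 := norm_jacobiTheta_sub_one_le (τ := σ) (by linarith)
  have hlt : Real.exp (-Real.pi * σ.im) ≤ 1 / 2 := by
    have := Real.add_one_le_exp (Real.pi * σ.im)
    rw [neg_mul, Real.exp_neg, inv_le_comm₀ (Real.exp_pos _) (by norm_num)]
    nlinarith [Real.pi_gt_three]
  have hpos := Real.exp_pos (-Real.pi * σ.im)
  set e := Real.exp (-Real.pi * σ.im)
  have h2 : 2 / (1 - e) ≤ 4 := by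
    rw [div_le_iff₀ (by linarith)]; linarith
  have h3 : ‖jacobiTheta σ - 1‖ ≤ 4 * e := h1.trans (by gcongr)
  have h4 : ‖jacobiTheta σ + 1‖ ≤ 4 := by
    calc ‖jacobiTheta σ + 1‖ = ‖(jacobiTheta σ - 1) + 2‖ := by ring_nf
      _ ≤ ‖jacobiTheta σ - 1‖ + ‖(2 : ℂ)‖ := norm_add_le _ _
      _ ≤ 4 := by rw [Complex.norm_two]; linarith
  calc ‖jacobiTheta σ ^ 2 - 1‖ = ‖jacobiTheta σ - 1‖ * ‖jacobiTheta σ + 1‖ := by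
        rw [← norm_mul]; ring_nf
    _ ≤ 4 * e * 4 := by gcongr
    _ = 16 * e := by ring

theorem jacobiTheta_sq_inversion {τ : ℂ} (h0 : τ ≠ 0) :
    jacobiTheta τ ^ 2 = I / τ * jacobiTheta (-1 / τ) ^ 2 := by
  have h : ((-I * τ) ^ (1 / 2 : ℂ)) ^ 2 = -I * τ := by
    rw [← Complex.cpow_nat_mul]; norm_num
  rw [jacobiTheta_eq_jacobiTheta₂, jacobiTheta_eq_jacobiTheta₂,
    jacobiTheta₂_functional_equation 0 τ]
  simp only [ne_eq, OfNat.ofNat_ne_zero, not_false_eq_true, zero_pow, mul_zero, zero_div,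
    Complex.exp_zero, mul_one, mul_pow, div_pow, h, one_pow]
  congr 1
  field_simp
  simp

theorem norm_sq_add_le (a b : ℂ) : ‖a + b‖ ^ 2 ≤ 2 * ‖a‖ ^ 2 + 2 * ‖b‖ ^ 2 := by
  have := norm_add_le a b
  nlinarith [norm_nonneg (a + b), sq_nonneg (‖a‖ - ‖b‖)]

theorem norm_sq_add_mul_I (a b : ℝ) : ‖(a : ℂ) + b * I‖ ^ 2 = a ^ 2 + b ^ 2 := by
  rw [← Complex.normSq_eq_norm_sq, Complex.normSq_add_mul_I]

/-- Under inversion θ² and the mean both have singular part i/τ at 0, and these cancel. What remains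
of θ² is exponentially small in v = Im(-1/τ); as |τ|⁻² = v/y, boundedness of v e^{-2πv} gives
O(1/y). -/
theorem norm_sq_excessSeries_le_of_near_zero {y α : ℝ} (hy : 0 < y) (hy' : y ≤ 1 / 200)
    (hα : α ^ 2 + y ^ 2 ≤ 2 * y) : ‖excessSeries y α‖ ^ 2 ≤ 600 / y := by
  set τ : ℂ := α + y * I with hτ
  have him : τ.im = y := by simp [hτ]
  have h0 : τ ≠ 0 := fun h => hy.ne' (by rw [← him, h]; simp)
  have hN : ‖τ‖ ^ 2 = α ^ 2 + y ^ 2 := norm_sq_add_mul_I α y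
  have hNpos : 0 < ‖τ‖ ^ 2 := by positivity
  set v : ℝ := y / ‖τ‖ ^ 2 with hv
  have hσ : (-1 / τ).im = v := by
    rw [neg_div, Complex.neg_im, one_div, Complex.inv_im, him, Complex.normSq_eq_norm_sq, hv]
    ring
  have hv3 : 1 / 3 ≤ v := by
    rw [hv, le_div_iff₀ hNpos]; linarith
  set z : ℂ := Real.pi * I * τ with hz
  have hpi : (Real.pi : ℂ) ≠ 0 := by exact_mod_cast Real.pi_ne_zero
  have hz0 : z ≠ 0 := by
    rw [hz]
    exact mul_ne_zero (mul_ne_zero hpi I_ne_zero) h0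
  have hzn : ‖z‖ ≤ 1 / 2 := by
    have : ‖z‖ ^ 2 = Real.pi ^ 2 * ‖τ‖ ^ 2 := by
      rw [hz, norm_mul, norm_mul, Complex.norm_real, Complex.norm_I, mul_one, mul_pow,
        Real.norm_eq_abs, sq_abs]
    have h10 : Real.pi ^ 2 ≤ 16 := by nlinarith [Real.pi_gt_three, Real.pi_le_four]
    refine abs_le_of_sq_le_sq' ?_ (by norm_num) |>.2
    rw [this, hN]
    nlinarith
  have hdecomp : excessSeries y α =
      I / τ * (jacobiTheta (-1 / τ) ^ 2 - 1) + Real.pi * (1 / (cexp z - 1) - 1 / z) := by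
    have e1 : I / τ = -(Real.pi / z) := by
      rw [hz]
      field_simp
      rw [I_sq]
    have e2 : (Real.pi : ℂ) / (1 - cexp z) = -(Real.pi / (cexp z - 1)) := by
      rw [← div_neg, neg_sub]
    rw [excessSeries, jacobiTheta_sq_inversion h0, ← hτ, ← hz, e2, e1]
    ring
  rw [hdecomp]
  refine (norm_sq_add_le _ _).trans ?_
  have hfirst : ‖I / τ * (jacobiTheta (-1 / τ) ^ 2 - 1)‖ ^ 2 ≤ 256 / y := by
    have h1 := norm_jacobiTheta_sq_sub_one_le (σ := -1 / τ) (by rw [hσ]; exact hv3)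
    rw [hσ] at h1
    rw [norm_mul, mul_pow, norm_div, Complex.norm_I, div_pow, one_pow]
    have h2 : 1 / ‖τ‖ ^ 2 = v / y := by rw [hv]; field_simp
    have h3 := pow_le_pow_left₀ (norm_nonneg _) h1 2
    have h4 : v * Real.exp (-Real.pi * v) ^ 2 ≤ 1 := by
      have hexp := Real.add_one_le_exp (Real.pi * v)
      have hle : v ≤ Real.exp (Real.pi * v) := by nlinarith [Real.pi_gt_three]
      have hm : Real.exp (Real.pi * v) * Real.exp (-Real.pi * v) = 1 := by
        rw [← Real.exp_add]; simp
      have hl : Real.exp (-Real.pi * v) ≤ 1 := Real.exp_le_one_iff.2 (by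
        nlinarith [Real.pi_gt_three])
      have hp := Real.exp_pos (-Real.pi * v)
      nlinarith
    rw [h2]
    calc v / y * ‖jacobiTheta (-1 / τ) ^ 2 - 1‖ ^ 2
        ≤ v / y * (16 * Real.exp (-Real.pi * v)) ^ 2 := by gcongr
      _ = 256 * (v * Real.exp (-Real.pi * v) ^ 2) / y := by ring
      _ ≤ 256 * 1 / y := by gcongr
      _ = 256 / y := by ring
  have hsecond : ‖(Real.pi : ℂ) * (1 / (cexp z - 1) - 1 / z)‖ ^ 2 ≤ 64 := by
    have h1 := norm_inv_exp_sub_one_sub_inv_le hz0 hzn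
    rw [norm_mul, Complex.norm_real, Real.norm_eq_abs, abs_of_pos Real.pi_pos]
    have : Real.pi * ‖1 / (cexp z - 1) - 1 / z‖ ≤ 4 * 2 := by
      have := Real.pi_le_four
      gcongr
    calc _ ≤ ((4 : ℝ) * 2) ^ 2 := by gcongr
      _ = 64 := by norm_num
  have h200 : 200 ≤ 1 / y := by
    rw [le_div_iff₀ hy]; linarith
  have e256 : 256 / y = 256 * (1 / y) := by ring
  have e600 : 600 / y = 600 * (1 / y) := by ring
  rw [e256] at hfirst
  rw [e600]
  linarith

/-- Here c and p are |c| and |d| for the cusp of `exists_jacobiTheta_pow_four_le`. Distance from 0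
and small y exclude c = 0 and d = 0. As |cα + d| ≤ 1/2 ≤ |d|/2, also |d| ≤ 2|c||α|. The signs are
lost, so the peaks at p/c and -p/c are both kept. -/
theorem exists_jacobiTheta_pow_four_le_away_from_zero :
    ∃ C : ℝ, 0 < C ∧ ∀ y α : ℝ, 0 < y → y ≤ 1 / 200 → |α| ≤ 1 → 2 * y < α ^ 2 + y ^ 2 →
      ∃ c p : ℕ, 1 ≤ c ∧ (c : ℝ) ^ 2 * y ≤ 2 ∧ 1 ≤ p ∧ p ≤ 2 * c ∧ (p : ℝ) ≤ 2 * (c * |α|) ∧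
        ‖jacobiTheta (α + y * I)‖ ^ 4 ≤
          C * (((c * α - p) ^ 2 + (c * y) ^ 2)⁻¹ + ((c * α + p) ^ 2 + (c * y) ^ 2)⁻¹) := by
  obtain ⟨C, hC, hmain⟩ := exists_jacobiTheta_pow_four_le
  refine ⟨C, hC, fun y α hy hy' hα hfar => ?_⟩
  obtain ⟨c, d, hcop, hle, hbd⟩ := hmain ⟨α + y * I, by simpa using hy⟩
  have hN : ‖(c : ℂ) * (α + y * I) + d‖ ^ 2 = (c * α + d) ^ 2 + (c * y) ^ 2 := by
    rw [← norm_sq_add_mul_I]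
    congr 2
    push_cast
    ring
  have him : UpperHalfPlane.im ⟨α + y * I, by simpa using hy⟩ = y := by
    simp [UpperHalfPlane.im]
  have hco : ((⟨α + y * I, by simpa using hy⟩ : ℍ) : ℂ) = α + y * I := rfl
  rw [hco, hN] at hle hbd
  rw [him] at hle
  have hc0 : c ≠ 0 := by
    rintro rfl
    have hd : IsUnit d := isCoprime_zero_left.1 hcop
    have hd2 : (d : ℝ) ^ 2 = 1 := by
      rcases Int.isUnit_iff.1 hd with rfl | rfl <;> norm_num
    norm_num [hd2] at hle
    linarith
  have hd0 : d ≠ 0 := by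
    rintro rfl
    have hc : IsUnit c := isCoprime_zero_right.1 hcop
    have hc2 : (c : ℝ) ^ 2 = 1 := by
      rcases Int.isUnit_iff.1 hc with rfl | rfl <;> norm_num
    simp only [Int.cast_zero, add_zero, mul_pow, hc2, one_mul] at hle
    linarith
  have hcpos : (0 : ℝ) < (c * y) ^ 2 := by positivity
  have hsq : (((c : ℝ) * α + d)) ^ 2 ≤ (1 / 2) ^ 2 := by nlinarith
  have habs : |(c : ℝ) * α + d| ≤ 1 / 2 := abs_le_of_sq_le_sq hsq (by norm_num)
  have hca : ((c.natAbs : ℕ) : ℝ) = |(c : ℝ)| := by rw [Nat.cast_natAbs]; push_cast; rfl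
  have hda : ((d.natAbs : ℕ) : ℝ) = |(d : ℝ)| := by rw [Nat.cast_natAbs]; push_cast; rfl
  have hc1 : 1 ≤ c.natAbs := Nat.one_le_iff_ne_zero.2 (Int.natAbs_ne_zero.2 hc0)
  have hd1 : 1 ≤ d.natAbs := Nat.one_le_iff_ne_zero.2 (Int.natAbs_ne_zero.2 hd0)
  have hc1' : (1 : ℝ) ≤ |(c : ℝ)| := by rw [← hca]; exact_mod_cast hc1
  have hd1' : (1 : ℝ) ≤ |(d : ℝ)| := by rw [← hda]; exact_mod_cast hd1
  have htri : |(d : ℝ)| ≤ |(c : ℝ)| * |α| + 1 / 2 := by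
    have := abs_sub ((c : ℝ) * α + d) (c * α)
    rw [add_sub_cancel_left, abs_mul] at this
    linarith
  have hdc : |(d : ℝ)| ≤ 2 * |(c : ℝ)| := by
    have := mul_le_mul_of_nonneg_left hα (abs_nonneg (c : ℝ))
    linarith
  refine ⟨c.natAbs, d.natAbs, hc1, ?_, hd1, ?_, ?_, ?_⟩
  · rw [hca, sq_abs]
    have : (c : ℝ) ^ 2 * y * y ≤ 2 * y := by nlinarith [sq_nonneg ((c : ℝ) * α + d)]
    exact le_of_mul_le_mul_right this hy
  · have : ((d.natAbs : ℕ) : ℝ) ≤ 2 * ((c.natAbs : ℕ) : ℝ) := by rw [hca, hda]; exact hdc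
    exact_mod_cast this
  · rw [hca, hda]
    linarith
  · have hpos : 0 < ((c : ℝ) * α + d) ^ 2 + (c * y) ^ 2 := by positivity
    rw [hca, hda]
    have hmul : ‖jacobiTheta (α + y * I)‖ ^ 4 ≤ C * (((c : ℝ) * α + d) ^ 2 + (c * y) ^ 2)⁻¹ := by
      rw [← div_eq_mul_inv, le_div_iff₀ hpos]
      exact hbd
    refine hmul.trans (mul_le_mul_of_nonneg_left ?_ hC.le)
    have hcy : (|(c : ℝ)| * y) ^ 2 = (c * y) ^ 2 := by rw [mul_pow, mul_pow, sq_abs]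
    rw [hcy]
    have p1 : 0 ≤ ((|(c : ℝ)| * α - |(d : ℝ)|) ^ 2 + (c * y) ^ 2)⁻¹ := by positivity
    have p2 : 0 ≤ ((|(c : ℝ)| * α + |(d : ℝ)|) ^ 2 + (c * y) ^ 2)⁻¹ := by positivity
    rcases abs_cases (c : ℝ) with ⟨h1, _⟩ | ⟨h1, _⟩ <;>
      rcases abs_cases (d : ℝ) with ⟨h2, _⟩ | ⟨h2, _⟩ <;> rw [h1, h2] at p1 p2 ⊢
    · linarith
    · rw [sub_neg_eq_add] at p1 ⊢
      linarith
    · rw [show -(c : ℝ) * α - d = -(c * α + d) by ring, neg_sq] at p1 ⊢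
      linarith
    · rw [show -(c : ℝ) * α + -d = -(c * α + d) by ring, neg_sq] at p2 ⊢
      linarith

/-- The relevant cusp depends on α; summing over all candidates removes this dependence and prepares
for integration. Since p ≤ 2c|α|, the decay W ≤ 1/α² becomes W ≤ 4c²/p². -/
theorem exists_norm_sq_excessSeries_mul_le :
    ∃ C : ℝ, 0 < C ∧ ∀ (y α h W : ℝ) (N : ℕ), 0 < y → y ≤ 1 / 200 → |α| ≤ 1 →
      0 ≤ W → W ≤ h ^ 2 → W * α ^ 2 ≤ 1 → (∀ c : ℕ, (c : ℝ) ^ 2 * y ≤ 2 → c ≤ N) →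
      ‖excessSeries y α‖ ^ 2 * W ≤ C * (h ^ 2 * (α ^ 2 + y)⁻¹ +
        ∑ c ∈ Finset.Icc 1 N, ∑ p ∈ Finset.Icc 1 (2 * N),
          min (h ^ 2) (4 * (c : ℝ) ^ 2 / (p : ℝ) ^ 2) *
          (((c * α - p) ^ 2 + (c * y) ^ 2)⁻¹ + ((c * α + p) ^ 2 + (c * y) ^ 2)⁻¹)) := by
  obtain ⟨C, hC, hmain⟩ := exists_jacobiTheta_pow_four_le_away_from_zero
  refine ⟨1800 + 2 * C, by positivity, fun y α h W N hy hy' hα hW0 hW1 hW2 hN => ?_⟩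
  set T : ℕ → ℕ → ℝ := fun c p => min (h ^ 2) (4 * (c : ℝ) ^ 2 / (p : ℝ) ^ 2) *
    (((c * α - p) ^ 2 + (c * y) ^ 2)⁻¹ + ((c * α + p) ^ 2 + (c * y) ^ 2)⁻¹) with hT
  have hT0 : ∀ c p, 0 ≤ T c p := fun c p => by simp only [hT]; positivity
  change _ ≤ (1800 + 2 * C) * (h ^ 2 * (α ^ 2 + y)⁻¹ +
    ∑ c ∈ Finset.Icc 1 N, ∑ p ∈ Finset.Icc 1 (2 * N), T c p)
  have hS0 : 0 ≤ ∑ c ∈ Finset.Icc 1 N, ∑ p ∈ Finset.Icc 1 (2 * N), T c p :=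
    Finset.sum_nonneg fun c _ => Finset.sum_nonneg fun p _ => hT0 c p
  set S := ∑ c ∈ Finset.Icc 1 N, ∑ p ∈ Finset.Icc 1 (2 * N), T c p
  have hay : 0 < α ^ 2 + y := by positivity
  have hA0 : 0 ≤ h ^ 2 * (α ^ 2 + y)⁻¹ := by positivity
  rcases le_or_gt (α ^ 2 + y ^ 2) (2 * y) with hnear | hfar
  · have h1 := norm_sq_excessSeries_le_of_near_zero hy hy' hnear
    have h2 : 600 / y ≤ 1800 * (α ^ 2 + y)⁻¹ := by
      rw [← div_eq_mul_inv, div_le_div_iff₀ hy hay]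
      nlinarith
    calc ‖excessSeries y α‖ ^ 2 * W ≤ 1800 * (α ^ 2 + y)⁻¹ * h ^ 2 := by
          gcongr
          exact h1.trans h2
      _ = 1800 * (h ^ 2 * (α ^ 2 + y)⁻¹) := by ring
      _ ≤ _ := by nlinarith
  · have hyα : y ≤ α ^ 2 := by nlinarith
    have hα2 : 0 < α ^ 2 := by linarith
    obtain ⟨c, p, hc1, hcy, hp1, hpc, hpα, hθ⟩ := hmain y α hy hy' hα hfar
    have hgeo := norm_sq_one_sub_exp_ge hα y
    have hexp : 1 / 2 ≤ Real.exp (-(Real.pi * y)) := by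
      have := Real.add_one_le_exp (-(Real.pi * y))
      nlinarith [Real.pi_le_four]
    have hgeo' : 2 * α ^ 2 ≤ ‖1 - cexp (Real.pi * I * (α + y * I))‖ ^ 2 := by nlinarith
    have hmainterm : ‖(Real.pi : ℂ) / (1 - cexp (Real.pi * I * (α + y * I)))‖ ^ 2 ≤
        16 * (α ^ 2 + y)⁻¹ := by
      rw [norm_div, div_pow, Complex.norm_real, Real.norm_eq_abs, sq_abs, ← div_eq_mul_inv,
        div_le_div_iff₀ (by linarith) hay]
      have h16 : Real.pi ^ 2 ≤ 16 := by nlinarith [Real.pi_gt_three, Real.pi_le_four]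
      nlinarith
    have hf : ‖excessSeries y α‖ ^ 2 ≤ 2 * ‖jacobiTheta (α + y * I)‖ ^ 4 +
        2 * (16 * (α ^ 2 + y)⁻¹) := by
      rw [excessSeries, sub_eq_add_neg]
      refine (norm_sq_add_le _ _).trans ?_
      rw [norm_neg, norm_pow, ← pow_mul]
      linarith
    have hW : W ≤ min (h ^ 2) (4 * (c : ℝ) ^ 2 / (p : ℝ) ^ 2) := by
      refine le_min hW1 ?_
      have hp0 : (0 : ℝ) < p := by exact_mod_cast hp1
      rw [le_div_iff₀ (by positivity)]
      have h1 := pow_le_pow_left₀ hp0.le hpα 2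
      rw [mul_pow, mul_pow, sq_abs] at h1
      calc W * (p : ℝ) ^ 2 ≤ W * (2 ^ 2 * ((c : ℝ) ^ 2 * α ^ 2)) := by gcongr
        _ = 4 * (c : ℝ) ^ 2 * (W * α ^ 2) := by ring
        _ ≤ 4 * (c : ℝ) ^ 2 * 1 := by gcongr
        _ = _ := by ring
    have hcN : c ≤ N := hN c hcy
    have hTS : T c p ≤ S := by
      have a1 : T c p ≤ ∑ p ∈ Finset.Icc 1 (2 * N), T c p :=
        Finset.single_le_sum (f := fun p => T c p) (fun q _ => hT0 c q)
          (Finset.mem_Icc.2 ⟨hp1, by omega⟩)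
      have a2 : ∑ p ∈ Finset.Icc 1 (2 * N), T c p ≤ S :=
        Finset.single_le_sum (f := fun c => ∑ p ∈ Finset.Icc 1 (2 * N), T c p)
          (fun q _ => Finset.sum_nonneg fun p _ => hT0 q p) (Finset.mem_Icc.2 ⟨hc1, hcN⟩)
      exact a1.trans a2
    have hθW : ‖jacobiTheta (α + y * I)‖ ^ 4 * W ≤ C * T c p := by
      calc ‖jacobiTheta (α + y * I)‖ ^ 4 * W ≤
            C * (((c * α - p) ^ 2 + (c * y) ^ 2)⁻¹ + ((c * α + p) ^ 2 + (c * y) ^ 2)⁻¹) *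
              min (h ^ 2) (4 * (c : ℝ) ^ 2 / (p : ℝ) ^ 2) := by gcongr
        _ = C * T c p := by simp only [hT]; ring
    have hCT : C * T c p ≤ C * S := by gcongr
    have hAW : (α ^ 2 + y)⁻¹ * W ≤ h ^ 2 * (α ^ 2 + y)⁻¹ := by
      rw [mul_comm]; gcongr
    have hCA : 0 ≤ C * (h ^ 2 * (α ^ 2 + y)⁻¹) := by positivity
    have := mul_le_mul_of_nonneg_right hf hW0
    nlinarith

/-! ### The weighted mean square of the excess series -/

theorem intervalIntegral_inv_sq_add_sq_le {c b : ℝ} (hc : 0 < c) (hb : 0 < b) (t u v : ℝ) :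
    ∫ α in u..v, ((c * α + t) ^ 2 + b ^ 2)⁻¹ ≤ Real.pi / (c * b) := by
  have hd : ∀ α ∈ Set.uIcc u v, HasDerivAt (fun α => Real.arctan ((c * α + t) / b) / (c * b))
      (((c * α + t) ^ 2 + b ^ 2)⁻¹) α := by
    intro α _
    have h1 : HasDerivAt (fun α : ℝ => (c * α + t) / b) (c / b) α := by
      simpa using (((hasDerivAt_id α).const_mul c).add_const t).div_const b
    refine (h1.arctan.div_const (c * b)).congr_deriv ?_
    have h2 : (c * α + t) ^ 2 + b ^ 2 ≠ 0 := by positivity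
    have h3 : 1 + ((c * α + t) / b) ^ 2 ≠ 0 := by positivity
    field_simp
    ring
  have hcont : Continuous fun α : ℝ => ((c * α + t) ^ 2 + b ^ 2)⁻¹ :=
    Continuous.inv₀ (by fun_prop) fun α => by positivity
  rw [intervalIntegral.integral_eq_sub_of_hasDerivAt hd (hcont.intervalIntegrable _ _), ← sub_div]
  gcongr
  have h1 := Real.arctan_lt_pi_div_two ((c * v + t) / b)
  have h2 := Real.neg_pi_div_two_lt_arctan ((c * u + t) / b)
  linarith

/-- Cut at p = b/a: the head contributes at most ab, the tail at most 2ab. -/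
theorem sum_min_sq_div_sq_le {a b : ℝ} (ha : 0 < a) (hb : 0 < b) (M : ℕ) :
    ∑ p ∈ Finset.Icc 1 M, min (a ^ 2) (b ^ 2 / (p : ℝ) ^ 2) ≤ 3 * (a * b) := by
  set K := ⌊b / a⌋₊ with hK
  have hK1 : (K : ℝ) * a ≤ b := by
    rw [← le_div_iff₀ ha]; exact Nat.floor_le (by positivity)
  have hK2 : b < (K + 1) * a := by
    rw [← div_lt_iff₀ ha]; exact Nat.lt_floor_add_one _
  have hsub : Finset.Icc 1 M ⊆ Finset.Icc 1 K ∪ Finset.Ioo K (M + 1) := by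
    intro p hp
    simp only [Finset.mem_Icc, Finset.mem_union, Finset.mem_Ioo] at hp ⊢
    omega
  have hnn (p : ℕ) : 0 ≤ min (a ^ 2) (b ^ 2 / (p : ℝ) ^ 2) := by positivity
  have h1 : ∑ p ∈ Finset.Icc 1 K, min (a ^ 2) (b ^ 2 / (p : ℝ) ^ 2) ≤ a * b := by
    calc _ ≤ ∑ p ∈ Finset.Icc 1 K, a ^ 2 := Finset.sum_le_sum fun p _ => min_le_left _ _
      _ = K * a * a := by simp; ring
      _ ≤ b * a := by gcongr
      _ = a * b := mul_comm _ _
  have h2 : ∑ p ∈ Finset.Ioo K (M + 1), min (a ^ 2) (b ^ 2 / (p : ℝ) ^ 2) ≤ 2 * (a * b) := by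
    calc _ ≤ ∑ p ∈ Finset.Ioo K (M + 1), b ^ 2 * ((p : ℝ) ^ 2)⁻¹ :=
          Finset.sum_le_sum fun p _ => (min_le_right _ _).trans_eq (div_eq_mul_inv _ _)
      _ = b ^ 2 * ∑ p ∈ Finset.Ioo K (M + 1), ((p : ℝ) ^ 2)⁻¹ := by rw [Finset.mul_sum]
      _ ≤ b ^ 2 * (2 / (K + 1)) := by gcongr; exact sum_Ioo_inv_sq_le K (M + 1)
      _ ≤ 2 * (a * b) := by
          rw [mul_div_assoc', div_le_iff₀ (by positivity)]
          nlinarith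
  calc _ ≤ ∑ p ∈ Finset.Icc 1 K ∪ Finset.Ioo K (M + 1), min (a ^ 2) (b ^ 2 / (p : ℝ) ^ 2) :=
        Finset.sum_le_sum_of_subset_of_nonneg hsub fun p _ _ => hnn p
    _ ≤ 3 * (a * b) := by
        have h3 := Finset.sum_union_inter (s₁ := Finset.Icc 1 K) (s₂ := Finset.Ioo K (M + 1))
          (f := fun p : ℕ => min (a ^ 2) (b ^ 2 / (p : ℝ) ^ 2))
        have h4 := Finset.sum_nonneg (s := Finset.Icc 1 K ∩ Finset.Ioo K (M + 1))
          fun p _ => hnn p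
        linarith

theorem one_sub_exp_ne_zero {y : ℝ} (hy : 0 < y) (α : ℝ) :
    1 - cexp (Real.pi * I * (α + y * I)) ≠ 0 := by
  intro h
  have h1 : ‖cexp (Real.pi * I * (α + y * I))‖ = 1 := by rw [← sub_eq_zero.1 h, norm_one]
  rw [Complex.norm_exp, Real.exp_eq_one_iff] at h1
  simp at h1
  exact hy.ne' h1

theorem continuous_jacobiTheta_add_mul_I {y : ℝ} (hy : 0 < y) :
    Continuous fun α : ℝ => jacobiTheta (α + y * I) := by
  refine continuous_iff_continuousAt.2 fun α => ?_
  exact (continuousAt_jacobiTheta (τ := α + y * I) (by simpa using hy)).comp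
    (f := fun α : ℝ => (α : ℂ) + y * I) (by fun_prop)

theorem continuous_excessSeries {y : ℝ} (hy : 0 < y) : Continuous (excessSeries y) :=
  ((continuous_jacobiTheta_add_mul_I hy).pow 2).sub
    (continuous_const.div (by fun_prop) (one_sub_exp_ne_zero hy))

theorem exists_intervalIntegral_norm_sq_excessSeries_mul_le :
    ∃ C : ℝ, 0 < C ∧ ∀ (y h : ℝ) (W : ℝ → ℝ), 0 < y → y ≤ 1 / 200 → 0 < h → Continuous W →
      (∀ α, 0 ≤ W α) → (∀ α, W α ≤ h ^ 2) → (∀ α, |α| ≤ 1 → W α * α ^ 2 ≤ 1) →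
      ∫ α in (-1 : ℝ)..1, ‖excessSeries y α‖ ^ 2 * W α ≤
        C * (h ^ 2 / Real.sqrt y + h / y * (1 + Real.log (2 / y))) := by
  obtain ⟨C, hC, hmain⟩ := exists_norm_sq_excessSeries_mul_le
  refine ⟨C * 12 * Real.pi, by positivity, fun y h W hy hy' hh hWc hW0 hW1 hW2 => ?_⟩
  -- A crude bound, since c ≤ √(2/y) already; only log N enters.
  set N := ⌊2 / y⌋₊ with hN
  have hNc (c : ℕ) (hc : (c : ℝ) ^ 2 * y ≤ 2) : c ≤ N := by
    refine Nat.le_floor ?_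
    rw [le_div_iff₀ hy]
    have : (c : ℝ) ≤ (c : ℝ) ^ 2 := by exact_mod_cast Nat.le_self_pow (by norm_num) c
    nlinarith
  have hN1 : 1 ≤ N := hNc 1 (by norm_num; linarith)
  set w : ℕ → ℕ → ℝ := fun c p => min (h ^ 2) (4 * (c : ℝ) ^ 2 / (p : ℝ) ^ 2) with hw
  have hw0 (c p : ℕ) : 0 ≤ w c p := by simp only [hw]; positivity
  have hsq : 0 < Real.sqrt y := Real.sqrt_pos.2 hy
  have hcA : Continuous fun α : ℝ => (α ^ 2 + y)⁻¹ :=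
    Continuous.inv₀ (by fun_prop) fun α => by positivity
  have hcT (c p : ℕ) (hc : 1 ≤ c) (t : ℝ) :
      Continuous fun α : ℝ => ((c * α + t) ^ 2 + (c * y) ^ 2)⁻¹ :=
    Continuous.inv₀ (by fun_prop) fun α => by
      have : (0 : ℝ) < c := by exact_mod_cast hc
      positivity
  set G : ℕ → ℕ → ℝ → ℝ := fun c p α =>
    w c p * (((c * α - p) ^ 2 + (c * y) ^ 2)⁻¹ + ((c * α + p) ^ 2 + (c * y) ^ 2)⁻¹) with hG
  have hGc (c p : ℕ) (hc : 1 ≤ c) : Continuous (G c p) :=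
    continuous_const.mul ((hcT c p hc (-p)).add (hcT c p hc p))
  have hGi (c p : ℕ) (hc : 1 ≤ c) :
      ∫ α in (-1 : ℝ)..1, G c p α ≤ w c p * (2 * (Real.pi / ((c : ℝ) ^ 2 * y))) := by
    have hc' : (0 : ℝ) < c := by exact_mod_cast hc
    simp only [hG]
    rw [intervalIntegral.integral_const_mul]
    refine mul_le_mul_of_nonneg_left ?_ (hw0 c p)
    have i1 := intervalIntegral_inv_sq_add_sq_le hc' (mul_pos hc' hy) (-p) (-1) 1
    have i2 := intervalIntegral_inv_sq_add_sq_le hc' (mul_pos hc' hy) p (-1) 1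
    have i3 := intervalIntegral.integral_add (μ := MeasureTheory.volume) ((hcT c p hc (-p)).intervalIntegrable (-1) 1)
      ((hcT c p hc p).intervalIntegrable (-1) 1)
    simp only [← sub_eq_add_neg] at i3 i1
    rw [i3, show (c : ℝ) ^ 2 * y = c * (c * y) by ring]
    linarith
  have hGs (c : ℕ) (hc : 1 ≤ c) :
      ∑ p ∈ Finset.Icc 1 (2 * N), w c p * (2 * (Real.pi / ((c : ℝ) ^ 2 * y))) ≤
        12 * Real.pi * (h / y) * (c : ℝ)⁻¹ := by
    have hc' : (0 : ℝ) < c := by exact_mod_cast hc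
    rw [← Finset.sum_mul]
    have h1 := sum_min_sq_div_sq_le hh (show 0 < 2 * (c : ℝ) by positivity) (2 * N)
    simp only [mul_pow, show (2 : ℝ) ^ 2 = 4 by norm_num] at h1
    calc _ ≤ 3 * (h * (2 * c)) * (2 * (Real.pi / ((c : ℝ) ^ 2 * y))) := by
          gcongr
      _ = 12 * Real.pi * (h / y) * (c : ℝ)⁻¹ := by field_simp; ring
  have hpt : ∀ α ∈ Set.Icc (-1 : ℝ) 1, ‖excessSeries y α‖ ^ 2 * W α ≤
      C * (h ^ 2 * (α ^ 2 + y)⁻¹ +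
        ∑ c ∈ Finset.Icc 1 N, ∑ p ∈ Finset.Icc 1 (2 * N), G c p α) := fun α hα =>
    hmain y α h (W α) N hy hy' (abs_le.2 hα) (hW0 α) (hW1 α) (hW2 α (abs_le.2 hα)) hNc
  have hsumc : Continuous fun α => ∑ c ∈ Finset.Icc 1 N, ∑ p ∈ Finset.Icc 1 (2 * N), G c p α :=
    continuous_finsetSum _ fun c hc => continuous_finsetSum _ fun p _ =>
      hGc c p (Finset.mem_Icc.1 hc).1
  have hLc : Continuous fun α => ‖excessSeries y α‖ ^ 2 * W α :=
    ((continuous_excessSeries hy).norm.pow 2).mul hWc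
  have hRc : Continuous fun α => C * (h ^ 2 * (α ^ 2 + y)⁻¹ +
      ∑ c ∈ Finset.Icc 1 N, ∑ p ∈ Finset.Icc 1 (2 * N), G c p α) :=
    continuous_const.mul ((continuous_const.mul hcA).add hsumc)
  have hint := intervalIntegral.integral_mono_on (μ := MeasureTheory.volume) (by norm_num : (-1 : ℝ) ≤ 1)
    (hLc.intervalIntegrable _ _) (hRc.intervalIntegrable _ _) hpt
  refine hint.trans ?_
  rw [intervalIntegral.integral_const_mul, intervalIntegral.integral_add
    ((hcA.const_mul (h ^ 2)).intervalIntegrable _ _) (hsumc.intervalIntegrable _ _),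
    intervalIntegral.integral_const_mul, intervalIntegral.integral_finsetSum fun c hc =>
      (continuous_finsetSum _ fun p _ =>
        hGc c p (Finset.mem_Icc.1 hc).1).intervalIntegrable _ _]
  have hA : ∫ α in (-1 : ℝ)..1, (α ^ 2 + y)⁻¹ ≤ Real.pi / Real.sqrt y := by
    have := intervalIntegral_inv_sq_add_sq_le one_pos hsq 0 (-1) 1
    simpa [Real.sq_sqrt hy.le] using this
  have hB : ∑ c ∈ Finset.Icc 1 N, ∫ α in (-1 : ℝ)..1, ∑ p ∈ Finset.Icc 1 (2 * N), G c p α ≤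
      12 * Real.pi * (h / y) * (1 + Real.log (2 / y)) := by
    calc _ ≤ ∑ c ∈ Finset.Icc 1 N, 12 * Real.pi * (h / y) * (c : ℝ)⁻¹ := by
          refine Finset.sum_le_sum fun c hc => ?_
          have hc1 := (Finset.mem_Icc.1 hc).1
          rw [intervalIntegral.integral_finsetSum fun p _ => (hGc c p hc1).intervalIntegrable _ _]
          exact (Finset.sum_le_sum fun p _ => hGi c p hc1).trans (hGs c hc1)
      _ = 12 * Real.pi * (h / y) * (harmonic N : ℝ) := by
          rw [← Finset.mul_sum, harmonic_eq_sum_Icc]; push_cast; rfl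
      _ ≤ 12 * Real.pi * (h / y) * (1 + Real.log (2 / y)) := by
          gcongr
          refine (harmonic_le_one_add_log N).trans ?_
          gcongr
          exact Nat.floor_le (by positivity)
  calc _ ≤ C * (h ^ 2 * (Real.pi / Real.sqrt y) +
        12 * Real.pi * (h / y) * (1 + Real.log (2 / y))) := by gcongr
    _ ≤ C * (12 * (h ^ 2 * (Real.pi / Real.sqrt y)) +
        12 * Real.pi * (h / y) * (1 + Real.log (2 / y))) := by
        have : 0 ≤ h ^ 2 * (Real.pi / Real.sqrt y) := by positivity
        exact mul_le_mul_of_nonneg_left (by linarith) hC.le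
    _ = _ := by ring

/-! ### Fourier coefficients and Bessel's inequality -/

theorem integral_exp_int_mul (k : ℤ) :
    ∫ α in (-1 : ℝ)..1, cexp (Real.pi * I * k * α) = if k = 0 then 2 else 0 := by
  split_ifs with hk
  · subst hk
    norm_num
  · have hc : (Real.pi : ℂ) * I * k ≠ 0 := by
      refine mul_ne_zero (mul_ne_zero ?_ I_ne_zero) (by exact_mod_cast hk)
      exact_mod_cast Real.pi_ne_zero
    rw [integral_exp_mul_complex hc, div_eq_zero_iff]
    left
    rw [sub_eq_zero, Complex.exp_eq_exp_iff_exists_int]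
    refine ⟨k, ?_⟩
    push_cast
    ring

/-- Integrating an absolutely convergent trigonometric series against a character extracts a
coefficient. -/
theorem hasSum_integral_tsum_mul_exp {ι : Type*} [Countable ι] (c : ι → ℂ) (k : ι → ℤ)
    (hc : Summable fun i => ‖c i‖) (m : ℤ) :
    HasSum (fun i => if k i = m then 2 * c i else 0)
      (∫ α in (-1 : ℝ)..1, (∑' i, c i * cexp (Real.pi * I * k i * α)) *
        cexp (-(Real.pi * I * m * α))) := by
  have hn (j : ℤ) (α : ℝ) : ‖cexp (Real.pi * I * j * α)‖ = 1 := by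
    rw [show (Real.pi : ℂ) * I * j * α = ((Real.pi * j * α : ℝ) : ℂ) * I by push_cast; ring]
    exact Complex.norm_exp_ofReal_mul_I _
  have hmul (i : ι) (α : ℝ) : c i * cexp (Real.pi * I * k i * α) * cexp (-(Real.pi * I * m * α)) =
      c i * cexp (Real.pi * I * (k i - m : ℤ) * α) := by
    rw [mul_assoc, ← Complex.exp_add]
    push_cast
    ring_nf
  have hsum (α : ℝ) : Summable fun i => c i * cexp (Real.pi * I * k i * α) := by
    refine Summable.of_norm ?_
    simp_rw [norm_mul, hn, mul_one]
    exact hc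
  have h := intervalIntegral.hasSum_integral_of_dominated_convergence
    (μ := MeasureTheory.volume) (a := -1) (b := 1)
    (F := fun (i : ι) (α : ℝ) => c i * cexp (Real.pi * I * (k i - m : ℤ) * α))
    (f := fun α : ℝ => (∑' i, c i * cexp (Real.pi * I * k i * α)) * cexp (-(Real.pi * I * m * α)))
    (fun i _ => ‖c i‖)
    (fun i => (by fun_prop : Continuous fun α : ℝ =>
      c i * cexp (Real.pi * I * (k i - m : ℤ) * α)).aestronglyMeasurable)
    (fun i => Filter.Eventually.of_forall fun α _ => by rw [norm_mul, hn, mul_one])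
    (Filter.Eventually.of_forall fun α _ => hc)
    (by simp)
    (Filter.Eventually.of_forall fun α _ => by
      simpa only [hmul] using (hsum α).hasSum.mul_right (cexp (-(Real.pi * I * m * α))))
  refine h.congr_fun fun i => ?_
  rw [intervalIntegral.integral_const_mul, integral_exp_int_mul]
  simp only [sub_eq_zero, mul_ite, mul_zero]
  split_ifs <;> ring

theorem summable_exp_neg_pi_mul_sq {y : ℝ} (hy : 0 < y) :
    Summable fun n : ℤ => Real.exp (-(Real.pi * (n : ℝ) ^ 2 * y)) := by
  have h := ((summable_jacobiTheta₂_term_iff 0 (y * I)).2 (by simpa using hy)).norm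
  refine h.congr fun n => ?_
  rw [norm_jacobiTheta₂_term]
  simp

theorem jacobiTheta_sq_eq_tsum {y : ℝ} (hy : 0 < y) (α : ℝ) :
    jacobiTheta (α + y * I) ^ 2 =
      ∑' p : ℤ × ℤ, ((Real.exp (-(Real.pi * (p.1 : ℝ) ^ 2 * y)) *
        Real.exp (-(Real.pi * (p.2 : ℝ) ^ 2 * y)) : ℝ) : ℂ) *
          cexp (Real.pi * I * (p.1 ^ 2 + p.2 ^ 2 : ℤ) * α) := by
  have hterm (n : ℤ) : cexp (Real.pi * I * (n : ℂ) ^ 2 * (α + y * I)) =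
      (Real.exp (-(Real.pi * (n : ℝ) ^ 2 * y)) : ℂ) * cexp (Real.pi * I * (n : ℂ) ^ 2 * α) := by
    rw [Complex.ofReal_exp, ← Complex.exp_add]
    congr 1
    push_cast
    linear_combination (Real.pi * (n : ℂ) ^ 2 * y) * I_mul_I
  have hn (n : ℤ) : ‖cexp (Real.pi * I * (n : ℂ) ^ 2 * (α + y * I))‖ =
      Real.exp (-(Real.pi * (n : ℝ) ^ 2 * y)) := by
    rw [hterm, norm_mul, Complex.norm_real, Real.norm_eq_abs, Real.abs_exp,
      show (Real.pi : ℂ) * I * n ^ 2 * α = ((Real.pi * n ^ 2 * α : ℝ) : ℂ) * I by push_cast; ring,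
      Complex.norm_exp_ofReal_mul_I, mul_one]
  have hs : Summable fun n : ℤ => ‖cexp (Real.pi * I * (n : ℂ) ^ 2 * (α + y * I))‖ := by
    simp_rw [hn]
    exact summable_exp_neg_pi_mul_sq hy
  rw [jacobiTheta, sq, tsum_mul_tsum_of_summable_norm hs hs]
  refine tsum_congr fun p => ?_
  rw [hterm, hterm]
  push_cast
  rw [mul_mul_mul_comm, ← Complex.exp_add (Real.pi * I * (p.1 : ℂ) ^ 2 * α)]
  ring_nf

theorem inv_one_sub_exp_eq_tsum {y : ℝ} (hy : 0 < y) (α : ℝ) :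
    (1 - cexp (Real.pi * I * (α + y * I)))⁻¹ =
      ∑' n : ℕ, ((Real.exp (-(Real.pi * y)) ^ n : ℝ) : ℂ) *
        cexp (Real.pi * I * (n : ℤ) * α) := by
  rw [← tsum_geometric_of_norm_lt_one]
  · refine tsum_congr fun n => ?_
    rw [← Complex.exp_nat_mul, ← Real.exp_nat_mul, Complex.ofReal_exp, ← Complex.exp_add]
    congr 1
    push_cast
    linear_combination (n * Real.pi * y) * I_mul_I
  · rw [Complex.norm_exp, Real.exp_lt_one_iff]
    simp only [mul_re, ofReal_re, I_re, mul_zero, ofReal_im, I_im, mul_one, sub_self, add_re,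
      zero_mul, mul_im, zero_add, add_im, add_zero, zero_sub, neg_lt_zero]
    positivity

/-- No pair (a, b) contributes to the coefficient of θ², so only the mean π survives; the factor 2
is the length of the period. -/
theorem integral_excessSeries_mul_exp {y : ℝ} (hy : 0 < y) {k : ℕ} (hk : 0 < k)
    (hns : ¬ IsPosSumTwoSq k) :
    ∫ α in (-1 : ℝ)..1, excessSeries y α * cexp (-(Real.pi * I * k * α)) =
      ((-(2 * Real.pi * Real.exp (-(Real.pi * y)) ^ k) : ℝ) : ℂ) := by
  have hs := summable_exp_neg_pi_mul_sq hy
  have h1 := hasSum_integral_tsum_mul_exp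
    (fun p : ℤ × ℤ => ((Real.exp (-(Real.pi * (p.1 : ℝ) ^ 2 * y)) *
        Real.exp (-(Real.pi * (p.2 : ℝ) ^ 2 * y)) : ℝ) : ℂ))
    (fun p => p.1 ^ 2 + p.2 ^ 2) (by
      simp only [Complex.norm_real, Real.norm_eq_abs, abs_mul, Real.abs_exp]
      exact hs.mul_of_nonneg hs (fun n => (Real.exp_pos _).le) (fun n => (Real.exp_pos _).le)) k
  have hz (p : ℤ × ℤ) : p.1 ^ 2 + p.2 ^ 2 ≠ (k : ℤ) := fun h => hns ⟨hk, p.1, p.2, h.symm⟩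
  simp only [hz, if_false, ← jacobiTheta_sq_eq_tsum hy] at h1
  have h1' := h1.unique hasSum_zero
  have hlt : Real.exp (-(Real.pi * y)) < 1 := Real.exp_lt_one_iff.2 (by
    have := mul_pos Real.pi_pos hy
    linarith)
  have h2 := hasSum_integral_tsum_mul_exp
    (fun n : ℕ => ((Real.exp (-(Real.pi * y)) ^ n : ℝ) : ℂ)) (fun n => (n : ℤ)) (by
      simp only [Complex.norm_real, Real.norm_eq_abs, abs_pow, Real.abs_exp]
      exact summable_geometric_of_lt_one (Real.exp_pos _).le hlt) k
  simp only [← inv_one_sub_exp_eq_tsum hy, Nat.cast_inj] at h2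
  have h2' := h2.unique (hasSum_ite_eq k (2 * ((Real.exp (-(Real.pi * y)) ^ k : ℝ) : ℂ)) |>.congr_fun
    fun n => by split_ifs with h <;> simp [h])
  have hsplit : ∀ α : ℝ, excessSeries y α * cexp (-(Real.pi * I * k * α)) =
      jacobiTheta (α + y * I) ^ 2 * cexp (-(Real.pi * I * (k : ℤ) * α)) -
      Real.pi * ((1 - cexp (Real.pi * I * (α + y * I)))⁻¹ *
        cexp (-(Real.pi * I * (k : ℤ) * α))) := by
    intro α
    rw [excessSeries]
    push_cast
    ring
  have hθc := continuous_jacobiTheta_add_mul_I hy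
  have hic : Continuous fun α : ℝ => (1 - cexp (Real.pi * I * (α + y * I)))⁻¹ :=
    Continuous.inv₀ (by fun_prop) fun α => one_sub_exp_ne_zero hy α
  simp_rw [hsplit]
  rw [intervalIntegral.integral_sub, intervalIntegral.integral_const_mul, h1', h2']
  · push_cast
    ring
  · exact ((hθc.pow 2).mul (by fun_prop)).intervalIntegrable _ _
  · exact (continuous_const.mul (hic.mul (by fun_prop))).intervalIntegrable _ _

/-- Bessel's inequality on `[-1, 1]`. -/
theorem sum_norm_sq_integral_mul_exp_le {F : ℝ → ℂ} (hF : Continuous F) (M : Finset ℕ) :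
    ∑ m ∈ M, ‖∫ α in (-1 : ℝ)..1, F α * cexp (-(Real.pi * I * m * α))‖ ^ 2 ≤
      2 * ∫ α in (-1 : ℝ)..1, ‖F α‖ ^ 2 := by
  have hab : (-1 : ℝ) < 1 := by norm_num
  have hL2 : MeasureTheory.MemLp F 2 (MeasureTheory.volume.restrict (Set.Ioc (-1 : ℝ) 1)) := by
    obtain ⟨B, hB⟩ := (isCompact_Icc (a := (-1 : ℝ)) (b := 1)).exists_bound_of_continuousOn
      hF.continuousOn
    exact MeasureTheory.MemLp.of_bound hF.aestronglyMeasurable B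
      (MeasureTheory.ae_restrict_of_forall_mem measurableSet_Ioc
        fun α hα => hB α (Set.Ioc_subset_Icc_self hα))
  have h := hasSum_sq_fourierCoeffOn hab hL2
  -- Normalised coefficients carry 1/2, hence 1/4 after squaring; Parseval carries 1/2 on the other
  -- side, which leaves the constant 2.
  have hcoef (m : ℕ) : ‖fourierCoeffOn hab F m‖ ^ 2 =
      4⁻¹ * ‖∫ α in (-1 : ℝ)..1, F α * cexp (-(Real.pi * I * m * α))‖ ^ 2 := by
    rw [fourierCoeffOn_eq_integral, norm_smul, mul_pow]
    congr 1
    · norm_num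
    · congr 2
      refine intervalIntegral.integral_congr fun α _ => ?_
      simp only [fourier_coe_apply, smul_eq_mul]
      rw [mul_comm]
      congr 2
      push_cast
      ring
  have h1 := sum_le_hasSum (M.map Nat.castEmbedding) (fun i _ => by positivity) h
  rw [Finset.sum_map] at h1
  simp only [Nat.castEmbedding_apply, hcoef, ← Finset.mul_sum, smul_eq_mul] at h1
  norm_num at h1
  linarith

/-! ### Counting empty windows -/

/-- The window cannot contain the first square (k + 1)² beyond m, whence h ≤ 2k + 1 ≤ 3k. -/
theorem le_three_mul_sqrt_of_window {x : ℝ} {m h : ℕ} (hm : 1 ≤ m) (hmx : (m + h : ℝ) ≤ x)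
    (hns : ∀ j < h, ¬ IsPosSumTwoSq (m + j)) : (h : ℝ) ≤ 3 * Real.sqrt x := by
  set k := Nat.sqrt m with hk
  have hk1 : k * k ≤ m := Nat.sqrt_le m
  have hk2 : m < (k + 1) * (k + 1) := Nat.lt_succ_sqrt m
  have hk0 : 1 ≤ k := Nat.sqrt_pos.2 hm
  have hle : m + h ≤ (k + 1) * (k + 1) := by
    by_contra hcon
    refine hns ((k + 1) * (k + 1) - m) (by omega) ?_
    rw [Nat.add_sub_cancel' hk2.le]
    refine ⟨by positivity, (k : ℤ) + 1, 0, ?_⟩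
    push_cast
    ring
  have h3 : h ≤ 3 * k := by nlinarith
  have hkx : (k : ℝ) ≤ Real.sqrt x := by
    refine Real.le_sqrt_of_sq_le ?_
    have : ((k * k : ℕ) : ℝ) ≤ m := by exact_mod_cast hk1
    push_cast at this
    nlinarith [(Nat.cast_nonneg h : (0 : ℝ) ≤ h)]
  calc (h : ℝ) ≤ 3 * k := by exact_mod_cast h3
    _ ≤ 3 * Real.sqrt x := by gcongr

/-- Windows of length `h` up to `x` free of sums of two squares are rare. -/
theorem exists_card_windows_mul_le :
    ∃ C : ℝ, 0 < C ∧ ∀ (x : ℝ) (h : ℕ) (M : Finset ℕ), 2 ≤ x → 1 ≤ h →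
      (∀ m ∈ M, 1 ≤ m ∧ (m + h : ℝ) ≤ x ∧ ∀ j < h, ¬ IsPosSumTwoSq (m + j)) →
      (M.card : ℝ) * h ≤ C * (x * Real.log x) := by
  obtain ⟨C, hC, hmain⟩ := exists_intervalIntegral_norm_sq_excessSeries_mul_le
  refine ⟨2500 * C, by positivity, fun x h M hx hh hM => ?_⟩
  have hx0 : 0 < x := by linarith
  have hlog : 1 / 2 ≤ Real.log x := by
    have := Real.log_two_gt_d9
    have := Real.log_le_log (by norm_num) hx
    linarith
  rcases M.eq_empty_or_nonempty with rfl | ⟨m₀, hm₀⟩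
  · simp only [Finset.card_empty, Nat.cast_zero, zero_mul]
    positivity
  have hhx : (h : ℝ) ≤ 3 * Real.sqrt x := by
    obtain ⟨h1, h2, h3⟩ := hM m₀ hm₀
    exact le_three_mul_sqrt_of_window h1 h2 h3
  have hh0 : (0 : ℝ) < h := by exact_mod_cast hh
  -- This keeps e^{-πyn} ≥ 24/25 for n ≤ x, and y ≤ 1/200 because x ≥ 2.
  set y : ℝ := 1 / (100 * x) with hy
  have hy0 : 0 < y := by positivity
  have hy1 : y ≤ 1 / 200 := by
    rw [hy]
    gcongr
    linarith
  set D : ℝ → ℂ := fun α => ∑ j ∈ Finset.range h, cexp (Real.pi * I * (-α : ℝ)) ^ j with hD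
  have hDc : Continuous D := by
    simp only [hD]
    fun_prop
  have hunit (α : ℝ) : ‖cexp (Real.pi * I * (-α : ℝ))‖ = 1 := by
    rw [Complex.norm_exp]
    simp
  have hD1 (α : ℝ) : ‖D α‖ ≤ h := by
    refine (norm_sum_le _ _).trans ?_
    simp_rw [norm_pow, hunit]
    simp
  have hI := hmain y h (fun α => ‖D α‖ ^ 2) hy0 hy1 hh0 (by fun_prop) (fun α => by positivity)
    (fun α => by gcongr; exact hD1 α) (fun α hα => by
      have := norm_sq_geom_sum_exp_le (α := -α) (by rwa [abs_neg]) h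
      rwa [neg_sq] at this)
  have hFc : Continuous fun α => excessSeries y α * D α := (continuous_excessSeries hy0).mul hDc
  have hB := sum_norm_sq_integral_mul_exp_le hFc M
  simp only [norm_mul, mul_pow] at hB
  have hlow : ∀ m ∈ M, (h : ℝ) ^ 2 ≤
      ‖∫ α in (-1 : ℝ)..1, excessSeries y α * D α * cexp (-(Real.pi * I * m * α))‖ ^ 2 := by
    intro m hm
    obtain ⟨hm1, hmx, hns⟩ := hM m hm
    have hexpand (α : ℝ) : excessSeries y α * D α * cexp (-(Real.pi * I * m * α)) =
        ∑ j ∈ Finset.range h, excessSeries y α * cexp (-(Real.pi * I * (m + j : ℕ) * α)) := by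
      simp only [hD]
      rw [mul_assoc, Finset.sum_mul, Finset.mul_sum]
      refine Finset.sum_congr rfl fun j _ => ?_
      rw [← Complex.exp_nat_mul, ← Complex.exp_add]
      push_cast
      ring_nf
    have hval : ∫ α in (-1 : ℝ)..1, excessSeries y α * D α * cexp (-(Real.pi * I * m * α)) =
        ((∑ j ∈ Finset.range h, -(2 * Real.pi * Real.exp (-(Real.pi * y)) ^ (m + j)) : ℝ) : ℂ) := by
      have hgc (j : ℕ) : Continuous fun α : ℝ =>
          excessSeries y α * cexp (-(Real.pi * I * (m + j : ℕ) * α)) :=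
        (continuous_excessSeries hy0).mul (by fun_prop)
      simp_rw [hexpand]
      rw [intervalIntegral.integral_finsetSum fun j _ =>
        (hgc j).intervalIntegrable _ _]
      rw [Complex.ofReal_sum]
      exact Finset.sum_congr rfl fun j hj =>
        integral_excessSeries_mul_exp hy0 (by omega) (hns j (Finset.mem_range.1 hj))
    have hterm : ∀ j ∈ Finset.range h,
        (1 : ℝ) ≤ 2 * Real.pi * Real.exp (-(Real.pi * y)) ^ (m + j) := by
      intro j hj
      have hjx : ((m + j : ℕ) : ℝ) ≤ x := by
        have : (j : ℝ) ≤ h := by exact_mod_cast (Finset.mem_range.1 hj).le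
        push_cast
        linarith
      rw [← Real.exp_nat_mul]
      have h1 := Real.add_one_le_exp (((m + j : ℕ) : ℝ) * -(Real.pi * y))
      have h2 : ((m + j : ℕ) : ℝ) * (Real.pi * y) ≤ x * (4 * y) := by
        have := Real.pi_le_four
        gcongr
      have h3 : x * (4 * y) = 1 / 25 := by rw [hy]; field_simp; norm_num
      nlinarith [Real.pi_gt_three]
    rw [hval, Complex.norm_real, Real.norm_eq_abs, sq_abs, Finset.sum_neg_distrib, neg_sq]
    have hsum := Finset.card_nsmul_le_sum (Finset.range h) _ 1 hterm
    simp only [Finset.card_range, nsmul_eq_mul, mul_one] at hsum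
    gcongr
  have hcount := Finset.card_nsmul_le_sum M _ _ hlow
  rw [nsmul_eq_mul] at hcount
  have htotal : (M.card : ℝ) * (h : ℝ) ^ 2 ≤
      2 * (C * ((h : ℝ) ^ 2 / Real.sqrt y + h / y * (1 + Real.log (2 / y)))) := by
    linarith
  have hsqrt : 1 / Real.sqrt y = 10 * Real.sqrt x := by
    rw [hy, Real.sqrt_div (by norm_num), Real.sqrt_mul (by norm_num), Real.sqrt_one,
      show (100 : ℝ) = 10 ^ 2 by norm_num, Real.sqrt_sq (by norm_num), one_div_one_div]
  have hlog2 : Real.log (2 / y) ≤ 9 * Real.log x := by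
    have e1 : 2 / y = 200 * x := by rw [hy]; field_simp; norm_num
    have e2 : Real.log 200 ≤ 8 * Real.log 2 := by
      rw [← Real.log_rpow (by norm_num)]
      exact Real.log_le_log (by norm_num) (by norm_num)
    rw [e1, Real.log_mul (by norm_num) hx0.ne']
    have := Real.log_le_log (by norm_num) hx
    linarith
  -- The bound h ≤ 3√x makes the contribution of the peak at 0 harmless.
  have e3 : (h : ℝ) ^ 2 / Real.sqrt y ≤ h * (30 * x) := by
    rw [div_eq_mul_one_div, hsqrt]
    have := Real.mul_self_sqrt hx0.le
    calc (h : ℝ) ^ 2 * (10 * Real.sqrt x) = h * (10 * Real.sqrt x * h) := by ring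
      _ ≤ h * (10 * Real.sqrt x * (3 * Real.sqrt x)) := by gcongr
      _ = h * (30 * (Real.sqrt x * Real.sqrt x)) := by ring
      _ = h * (30 * x) := by rw [this]
  have e4 : (h : ℝ) / y * (1 + Real.log (2 / y)) ≤ h * (1100 * (x * Real.log x)) := by
    have : (h : ℝ) / y = h * (100 * x) := by rw [hy]; field_simp
    rw [this]
    calc (h : ℝ) * (100 * x) * (1 + Real.log (2 / y)) ≤
          h * (100 * x) * (2 * Real.log x + 9 * Real.log x) := by
          gcongr
          linarith
      _ = h * (1100 * (x * Real.log x)) := by ring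
  have e5 : (h : ℝ) * (30 * x) ≤ h * (60 * (x * Real.log x)) := by
    have : x * (1 / 2) ≤ x * Real.log x := by gcongr
    gcongr ?_ * ?_
    linarith
  have hfin : (M.card : ℝ) * h * h ≤ 2500 * C * (x * Real.log x) * h := by
    calc (M.card : ℝ) * h * h = M.card * (h : ℝ) ^ 2 := by ring
      _ ≤ 2 * (C * ((h : ℝ) * (60 * (x * Real.log x)) + h * (1100 * (x * Real.log x)))) := by
          refine htotal.trans ?_
          gcongr
          exact e3.trans e5
      _ = 2320 * C * (x * Real.log x) * h := by ring
      _ ≤ 2500 * C * (x * Real.log x) * h := by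
          gcongr
          norm_num
  exact le_of_mul_le_mul_right hfin hh0

end

/-! ### From empty windows to moments of gaps -/

theorem not_isPosSumTwoSq_of_lt_of_lt {n k : ℕ} (h1 : sumTwoSqSeq n < k)
    (h2 : k < sumTwoSqSeq (n + 1)) : ¬ IsPosSumTwoSq k := by
  intro hk
  have h : k ∈ Set.range sumTwoSqSeq := by
    rw [range_sumTwoSqSeq]
    exact hk
  obtain ⟨i, rfl⟩ := h
  have := sumTwoSqSeq_strictMono.lt_iff_lt.1 h1
  have := sumTwoSqSeq_strictMono.lt_iff_lt.1 h2
  omega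

theorem pairwiseDisjoint_Ioc_sumTwoSqSeq (S : Set ℕ) (h : ℕ) :
    S.PairwiseDisjoint fun n => Finset.Ioc (sumTwoSqSeq n) (sumTwoSqSeq (n + 1) - h) := by
  have key {a b m : ℕ} (hab : a < b) (ha : m ≤ sumTwoSqSeq (a + 1)) (hb : sumTwoSqSeq b < m) :
      False := by
    have := sumTwoSqSeq_strictMono.monotone (Nat.succ_le_of_lt hab)
    simp only [Nat.succ_eq_add_one] at this
    omega
  intro a _ b _ hab
  refine Finset.disjoint_left.2 fun m hm hm' => ?_
  rw [Finset.mem_Ioc] at hm hm'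
  rcases lt_or_gt_of_ne hab with hlt | hlt
  · exact key hlt (hm.2.trans (Nat.sub_le _ _)) hm'.1
  · exact key hlt (hm'.2.trans (Nat.sub_le _ _)) hm.1

/-- Empty windows inside the n-th gap start in (s_n, s_{n+1} - h]. The truncated subtraction gives 0
for gaps of length at most h. -/
theorem exists_sum_gap_excess_mul_le :
    ∃ C : ℝ, 0 < C ∧ ∀ (x : ℝ) (h : ℕ), 2 ≤ x → 1 ≤ h →
      (∑ n ∈ (finite_gapIndex x).toFinset,
        ((sumTwoSqSeq (n + 1) - sumTwoSqSeq n - h : ℕ) : ℝ)) * h ≤ C * (x * Real.log x) := by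
  obtain ⟨C, hC, hmain⟩ := exists_card_windows_mul_le
  refine ⟨C, hC, fun x h hx hh => ?_⟩
  have h1 := hmain x h ((finite_gapIndex x).toFinset.biUnion fun n =>
    Finset.Ioc (sumTwoSqSeq n) (sumTwoSqSeq (n + 1) - h)) hx hh (by
      intro m hm
      obtain ⟨n, hn, hm⟩ := Finset.mem_biUnion.1 hm
      rw [Finset.mem_Ioc] at hm
      have hn' : (sumTwoSqSeq (n + 1) : ℝ) ≤ x := (finite_gapIndex x).mem_toFinset.1 hn
      refine ⟨by omega, ?_, fun j hj => ?_⟩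
      · have : m + h ≤ sumTwoSqSeq (n + 1) := by omega
        refine le_trans ?_ hn'
        exact_mod_cast this
      · exact not_isPosSumTwoSq_of_lt_of_lt (n := n) (by omega) (by omega))
  rw [Finset.card_biUnion (pairwiseDisjoint_Ioc_sumTwoSqSeq _ h)] at h1
  simpa only [Nat.card_Ioc, Nat.cast_sum, fun n => Nat.sub_right_comm (sumTwoSqSeq (n + 1)) h
    (sumTwoSqSeq n)] using h1

theorem sum_gap_le {x : ℝ} (hx : 0 ≤ x) :
    ∑ n ∈ (finite_gapIndex x).toFinset, ((sumTwoSqSeq (n + 1) - sumTwoSqSeq n : ℕ) : ℝ) ≤ x := by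
  have h1 := Finset.card_le_card (t := Finset.Ioc 0 ⌊x⌋₊)
    (s := (finite_gapIndex x).toFinset.biUnion fun n =>
      Finset.Ioc (sumTwoSqSeq n) (sumTwoSqSeq (n + 1) - 0)) (by
      intro m hm
      obtain ⟨n, hn, hm⟩ := Finset.mem_biUnion.1 hm
      rw [Finset.mem_Ioc] at hm
      have hn' : (sumTwoSqSeq (n + 1) : ℝ) ≤ x := (finite_gapIndex x).mem_toFinset.1 hn
      have := Nat.le_floor hn'
      exact Finset.mem_Ioc.2 ⟨by omega, by omega⟩)
  rw [Finset.card_biUnion (pairwiseDisjoint_Ioc_sumTwoSqSeq _ 0)] at h1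
  simp only [Nat.card_Ioc, Nat.sub_zero] at h1
  calc _ = ((∑ n ∈ (finite_gapIndex x).toFinset,
        (sumTwoSqSeq (n + 1) - sumTwoSqSeq n) : ℕ) : ℝ) := by push_cast; rfl
    _ ≤ (⌊x⌋₊ : ℝ) := by exact_mod_cast h1
    _ ≤ x := Nat.floor_le hx

/-- A power of `L` is dominated by its excesses over a geometric progression of thresholds. -/
theorem rpow_le_sum_excess {e : ℝ} (he : 0 ≤ e) {H : ℕ} (L J : ℕ)
    (hL : L ≤ 2 ^ (J + 1) * H) :
    (L : ℝ) ^ (e + 1) ≤ (2 * H : ℝ) ^ e * L +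
      ∑ j ∈ Finset.range J, 2 * (4 * (2 ^ j * H : ℕ) : ℝ) ^ e * ((L - 2 ^ j * H : ℕ) : ℝ) := by
  have hterm (k : ℕ) : 0 ≤ 2 * (4 * (k : ℝ)) ^ e * ((L - k : ℕ) : ℝ) := by positivity
  have hlow : 0 ≤ (2 * H : ℝ) ^ e * L := by positivity
  have hsum (J : ℕ) := Finset.sum_nonneg (s := Finset.range J) fun j _ => hterm (2 ^ j * H)
  rcases Nat.eq_zero_or_pos L with h0 | hLpos
  · have : (L : ℝ) ^ (e + 1) = 0 := by rw [h0, Nat.cast_zero, Real.zero_rpow (by linarith)]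
    linarith [hsum J]
  have hL0 : (0 : ℝ) < L := Nat.cast_pos.2 hLpos
  rw [Real.rpow_add_one hL0.ne']
  induction J with
  | zero =>
    rw [Finset.range_zero, Finset.sum_empty, add_zero]
    have h2 : L ≤ 2 * H := by simpa using hL
    have h3 : (L : ℝ) ≤ 2 * H := by exact_mod_cast h2
    exact mul_le_mul_of_nonneg_right (Real.rpow_le_rpow hL0.le h3 he) hL0.le
  | succ J ih =>
    rw [Finset.sum_range_succ]
    rcases le_or_gt L (2 ^ (J + 1) * H) with hle | hgt
    · linarith [ih hle, hterm (2 ^ J * H)]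
    -- For k = 2^J H one has 2k < L ≤ 4k, so L ≤ 2(L - k) and the new term alone dominates.
    · rw [pow_succ, mul_right_comm] at hgt
      rw [pow_succ, pow_succ, mul_right_comm, mul_right_comm (2 ^ J)] at hL
      have hsumJ := hsum J
      generalize 2 ^ J * H = k at hL hgt ⊢
      have h1 : (L : ℝ) ≤ 4 * (k : ℝ) := by
        have : L ≤ 4 * k := by omega
        exact_mod_cast this
      have h2 : (L : ℝ) ≤ 2 * ((L - k : ℕ) : ℝ) := by
        have : L ≤ 2 * (L - k) := by omega
        exact_mod_cast this
      have h3 : (L : ℝ) ^ e * L ≤ (4 * (k : ℝ)) ^ e * (2 * ((L - k : ℕ) : ℝ)) :=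
        mul_le_mul (Real.rpow_le_rpow hL0.le h1 he) h2 hL0.le (by positivity)
      linarith

/-- The moment of order `e + 1` of the gaps, with a geometric sum that is bounded for `e < 1` and
logarithmic for `e = 1`. -/
theorem exists_gapMoment_le_geom_sum :
    ∃ C : ℝ, 0 < C ∧ ∀ e x : ℝ, 0 ≤ e → e ≤ 1 → 2 ≤ x →
      gapMoment (e + 1) x ≤ x * Real.log x ^ e *
        (6 + C * ∑ j ∈ Finset.range ⌈Real.log x / Real.log 2⌉₊, ((2 : ℝ) ^ (e - 1)) ^ j) := by
  obtain ⟨C, hC, hmain⟩ := exists_sum_gap_excess_mul_le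
  refine ⟨8 * C, by positivity, fun e x he0 he1 hx => ?_⟩
  have hx0 : 0 < x := by linarith
  have hlog2 := Real.log_two_gt_d9
  have hlog : 1 / 2 ≤ Real.log x := by
    have := Real.log_le_log (by norm_num) hx
    linarith
  have hlog0 : 0 < Real.log x := by linarith
  set J := ⌈Real.log x / Real.log 2⌉₊ with hJ
  -- Below the threshold log x the window bound x log x / h is no better than the trivial bound x
  -- for the sum of the gaps.
  set H := ⌈Real.log x⌉₊ with hH
  set S := (finite_gapIndex x).toFinset with hS
  have hHle : Real.log x ≤ H := Nat.le_ceil _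
  have hHlt : (H : ℝ) < Real.log x + 1 := Nat.ceil_lt_add_one hlog0.le
  have hH1 : 1 ≤ H := Nat.ceil_pos.2 hlog0
  have hxJ : x ≤ 2 ^ J := by
    have h1 : Real.log x / Real.log 2 ≤ J := Nat.le_ceil _
    rw [div_le_iff₀ (by linarith), ← Real.log_pow] at h1
    exact (Real.log_le_log_iff hx0 (by positivity)).1 h1
  have hpoint : ∀ n ∈ S, ((sumTwoSqSeq (n + 1) : ℝ) - (sumTwoSqSeq n : ℝ)) ^ (e + 1) ≤
      (2 * H : ℝ) ^ e * ((sumTwoSqSeq (n + 1) - sumTwoSqSeq n : ℕ) : ℝ) +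
      ∑ j ∈ Finset.range J, 2 * (4 * (2 ^ j * H : ℕ) : ℝ) ^ e *
        ((sumTwoSqSeq (n + 1) - sumTwoSqSeq n - 2 ^ j * H : ℕ) : ℝ) := by
    intro n hn
    have hn' : (sumTwoSqSeq (n + 1) : ℝ) ≤ x := (finite_gapIndex x).mem_toFinset.1 hn
    rw [← Nat.cast_sub (sumTwoSqSeq_strictMono (Nat.lt_succ_self n)).le]
    refine rpow_le_sum_excess he0 _ J ?_
    have h1 : sumTwoSqSeq (n + 1) ≤ 2 ^ J := by exact_mod_cast hn'.trans hxJ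
    calc sumTwoSqSeq (n + 1) - sumTwoSqSeq n ≤ 2 ^ J * 1 := by omega
      _ ≤ 2 ^ (J + 1) * H := Nat.mul_le_mul (Nat.pow_le_pow_right (by norm_num) (by omega)) hH1
  have hlevel : ∀ j ∈ Finset.range J, ∑ n ∈ S, 2 * (4 * (2 ^ j * H : ℕ) : ℝ) ^ e *
        ((sumTwoSqSeq (n + 1) - sumTwoSqSeq n - 2 ^ j * H : ℕ) : ℝ) ≤
      x * Real.log x ^ e * (8 * C) * ((2 : ℝ) ^ (e - 1)) ^ j := by
    intro j _
    have hj1 : 1 ≤ 2 ^ j * H := Nat.one_le_iff_ne_zero.2 (by positivity)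
    have h1 := hmain x (2 ^ j * H) hx hj1
    rw [← Finset.mul_sum]
    set k : ℝ := ((2 ^ j * H : ℕ) : ℝ) with hk
    have hk0 : 0 < k := by
      rw [hk]
      exact Nat.cast_pos.2 hj1
    rw [← le_div_iff₀ hk0] at h1
    have h4 : (4 : ℝ) ^ e ≤ 4 := by
      calc (4 : ℝ) ^ e ≤ 4 ^ (1 : ℝ) := Real.rpow_le_rpow_of_exponent_le (by norm_num) he1
        _ = 4 := Real.rpow_one 4
    -- As e - 1 ≤ 0, replacing H by the smaller log x enlarges the power.
    have hke : k ^ e / k ≤ ((2 : ℝ) ^ (e - 1)) ^ j * Real.log x ^ (e - 1) := by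
      rw [← Real.rpow_sub_one hk0.ne', hk, Nat.cast_mul, Nat.cast_pow, Nat.cast_ofNat,
        Real.mul_rpow (by positivity) (by positivity)]
      have e1 : ((2 : ℝ) ^ j) ^ (e - 1) = ((2 : ℝ) ^ (e - 1)) ^ j := by
        rw [← Real.rpow_natCast, ← Real.rpow_natCast, ← Real.rpow_mul (by norm_num),
          ← Real.rpow_mul (by norm_num), mul_comm]
      rw [e1]
      exact mul_le_mul_of_nonneg_left
        (Real.rpow_le_rpow_of_nonpos hlog0 hHle (by linarith)) (by positivity)
    calc 2 * (4 * k) ^ e * ∑ n ∈ S,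
          ((sumTwoSqSeq (n + 1) - sumTwoSqSeq n - 2 ^ j * H : ℕ) : ℝ)
        ≤ 2 * (4 * k) ^ e * (C * (x * Real.log x) / k) := by gcongr
      _ = 2 * (4 : ℝ) ^ e * (C * (x * Real.log x)) * (k ^ e / k) := by
          rw [Real.mul_rpow (by norm_num) hk0.le]
          ring
      _ ≤ 2 * 4 * (C * (x * Real.log x)) *
          (((2 : ℝ) ^ (e - 1)) ^ j * Real.log x ^ (e - 1)) := by gcongr
      _ = x * Real.log x ^ e * (8 * C) * ((2 : ℝ) ^ (e - 1)) ^ j := by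
          rw [Real.rpow_sub_one hlog0.ne']
          field_simp
          ring
  have h2H : (2 * H : ℝ) ^ e ≤ 6 * Real.log x ^ e := by
    have h6 : (6 : ℝ) ^ e ≤ 6 := by
      calc (6 : ℝ) ^ e ≤ 6 ^ (1 : ℝ) := Real.rpow_le_rpow_of_exponent_le (by norm_num) he1
        _ = 6 := Real.rpow_one 6
    calc (2 * H : ℝ) ^ e ≤ (6 * Real.log x) ^ e := by
          exact Real.rpow_le_rpow (by positivity) (by linarith) he0
      _ = (6 : ℝ) ^ e * Real.log x ^ e := Real.mul_rpow (by norm_num) hlog0.le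
      _ ≤ 6 * Real.log x ^ e := by gcongr
  calc gapMoment (e + 1) x ≤ ∑ n ∈ S, ((2 * H : ℝ) ^ e *
        ((sumTwoSqSeq (n + 1) - sumTwoSqSeq n : ℕ) : ℝ) +
      ∑ j ∈ Finset.range J, 2 * (4 * (2 ^ j * H : ℕ) : ℝ) ^ e *
        ((sumTwoSqSeq (n + 1) - sumTwoSqSeq n - 2 ^ j * H : ℕ) : ℝ)) := Finset.sum_le_sum hpoint
    _ = (2 * H : ℝ) ^ e * ∑ n ∈ S, ((sumTwoSqSeq (n + 1) - sumTwoSqSeq n : ℕ) : ℝ) +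
      ∑ j ∈ Finset.range J, ∑ n ∈ S, 2 * (4 * (2 ^ j * H : ℕ) : ℝ) ^ e *
        ((sumTwoSqSeq (n + 1) - sumTwoSqSeq n - 2 ^ j * H : ℕ) : ℝ) := by
        rw [Finset.sum_add_distrib, ← Finset.mul_sum, Finset.sum_comm]
    _ ≤ 6 * Real.log x ^ e * x +
      ∑ j ∈ Finset.range J, x * Real.log x ^ e * (8 * C) * ((2 : ℝ) ^ (e - 1)) ^ j := by
        gcongr with j hj
        · exact sum_gap_le hx0.le
        · exact hlevel j hj
    _ = _ := by
        rw [← Finset.mul_sum]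
        ring

theorem theorem4 (γ : ℝ) (hγ₁ : 1 < γ) (hγ₂ : γ ≤ 2) :
    ∃ C : ℝ, 0 < C ∧ ∀ x : ℝ, 2 ≤ x →
      gapMoment γ x ≤
        C * (x * Real.log x ^ ((3 : ℝ) / 2 * (γ - 1)) * endpointFactor x γ) := by
  obtain ⟨C, hC, hmain⟩ := exists_gapMoment_le_geom_sum
  suffices h : ∃ K : ℝ, 0 < K ∧ ∀ x : ℝ, 2 ≤ x →
      6 + C * ∑ j ∈ Finset.range ⌈Real.log x / Real.log 2⌉₊, ((2 : ℝ) ^ (γ - 1 - 1)) ^ j ≤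
        K * endpointFactor x γ by
    obtain ⟨K, hK, hle⟩ := h
    refine ⟨2 * K, by positivity, fun x hx => ?_⟩
    have hlog : 1 / 2 ≤ Real.log x := by
      have := Real.log_le_log (by norm_num) hx
      have := Real.log_two_gt_d9
      linarith
    have hlog0 : 0 < Real.log x := by linarith
    -- The factor 2 is needed because log x may be below 1 for small x.
    have hexp : Real.log x ^ (γ - 1) ≤ 2 * Real.log x ^ ((3 : ℝ) / 2 * (γ - 1)) := by
      have h1 : (1 / 2 : ℝ) ≤ Real.log x ^ ((γ - 1) / 2) := by
        calc (1 / 2 : ℝ) = (1 / 2) ^ (1 : ℝ) := (Real.rpow_one _).symm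
          _ ≤ (1 / 2) ^ ((γ - 1) / 2) :=
              Real.rpow_le_rpow_of_exponent_ge (by norm_num) (by norm_num) (by linarith)
          _ ≤ _ := by gcongr
      rw [show (3 : ℝ) / 2 * (γ - 1) = (γ - 1) + (γ - 1) / 2 by ring, Real.rpow_add hlog0]
      have := Real.rpow_pos_of_pos hlog0 (γ - 1)
      nlinarith
    have hEnn : 0 ≤ endpointFactor x γ := by
      unfold endpointFactor
      split_ifs <;> linarith
    have h2 := hmain (γ - 1) x (by linarith) (by linarith) hx
    rw [sub_add_cancel] at h2
    calc gapMoment γ x ≤ x * Real.log x ^ (γ - 1) * (K * endpointFactor x γ) :=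
          h2.trans (by gcongr; exact hle x hx)
      _ ≤ x * (2 * Real.log x ^ ((3 : ℝ) / 2 * (γ - 1))) * (K * endpointFactor x γ) := by gcongr
      _ = _ := by ring
  -- For γ < 2 the geometric series converges; for γ = 2 its terms are all 1 and there are at most 4
  -- log x of them.
  rcases lt_or_eq_of_le hγ₂ with hlt | rfl
  · set r : ℝ := (2 : ℝ) ^ (γ - 1 - 1) with hr
    have hr0 : 0 ≤ r := by positivity
    have hr1 : r < 1 := Real.rpow_lt_one_of_one_lt_of_neg (by norm_num) (by linarith)
    have hinv : 0 < (1 - r)⁻¹ := inv_pos.2 (by linarith)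
    refine ⟨6 + C * (1 - r)⁻¹, by positivity, fun x _ => ?_⟩
    rw [endpointFactor, if_pos hlt, mul_one]
    gcongr
    rw [← tsum_geometric_of_lt_one hr0 hr1]
    exact (summable_geometric_of_lt_one hr0 hr1).sum_le_tsum _ fun i _ => by positivity
  · refine ⟨12 + 4 * C, by positivity, fun x hx => ?_⟩
    have hl2 := Real.log_two_gt_d9
    have hlog := Real.log_le_log (by norm_num) hx
    have hpow : (2 : ℝ) ^ ((2 : ℝ) - 1 - 1) = 1 := by norm_num
    have hJ : (⌈Real.log x / Real.log 2⌉₊ : ℝ) ≤ 4 * Real.log x := by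
      refine (Nat.ceil_lt_add_one (div_nonneg (by linarith) (by linarith))).le.trans ?_
      have : Real.log x / Real.log 2 ≤ 2 * Real.log x := by
        rw [div_le_iff₀ (by linarith)]
        nlinarith
      linarith
    simp only [hpow, one_pow, Finset.sum_const, Finset.card_range, nsmul_eq_mul, mul_one,
      endpointFactor, lt_irrefl, if_false]
    nlinarith
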